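/- Let $\Gamma_8=\pi_1(S^3\setminus K_8)=\langle m,n \mid mw=wn\rangle$, with $w=nm^{-1}n^{-1}m$, be the figure-eight knot group, and let $\rho_{\rm hyp}:\Gamma_8\to {\rm SO}^0(3,1)\subset{\rm SO}(3,1)$ be its hyperbolic representation, i.e. the holonomy of the complete finite-volume hyperbolic structure on $S^3\setminus K_8$ (the faithful representation whose image is a lattice; it is unique up to conjugation by isometries of real hyperbolic 3-space). For $u=e^{i\alpha}\in{\rm U}(1)$ put $$M_u=\begin{pmatrix}1&0&1&u/2-1\\0&1&1&u/2\\0&0&1&(u+1)/2\\0&0&0&1\end{pmatrix},\qquad N_u=\begin{pmatrix}1&0&0&0\\2(1+u^{-1})&1&0&0\\2&1&1&0\\1&1&0&1\end{pmatrix}.$$ Then for every $u\in{\rm U}(1)$ there is a representation $\rho_u:\Gamma_8\to{\rm SL}(4,\mathbb{C})$ with $\rho_u(m)=M_u$ and $\rho_u(n)=N_u$, and: 1. The family $(\rho_u)$ is a 1-parameter family of deformations of $\rho_{\rm hyp}$: $\rho_u(\gamma)$ depends continuously on $u$ for every $\gamma\in\Gamma_8$, $\rho_1$ is conjugate in ${\rm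 SL}(4,\mathbb{C})$ to $\rho_{\rm hyp}$, and $\rho_u$, $\rho_v$ are not conjugate in ${\rm SL}(4,\mathbb{C})$ when $u\neq v$. 2. If $|\alpha|<2\pi/3$, then $\rho_u$ is conjugate in ${\rm SL}(4,\mathbb{C})$ to a representation into ${\rm SU}(3,1)$, and every such representation $\sigma:\Gamma_8\to{\rm SU}(3,1)$ is parabolic-preserving: for every $\gamma\in\Gamma_8$, $\sigma(\gamma)$ is parabolic (resp. boundary elliptic) whenever $\rho_{\rm hyp}(\gamma)\in{\rm SO}(3,1)\subset{\rm SU}(3,1)$ is. 3. If $2\pi/3<|\alpha|<\pi$, then $\rho_u$ is conjugate in ${\rm SL}(4,\mathbb{C})$ to a representation into ${\rm SU}(2,2)$. 4. The image of $\rho_u$ is a discrete subgroup of ${\rm SL}(4,\mathbb{C})$ for $u=\pm1,\ \pm i,\ e^{\pm i\pi/3},\ e^{\pm 2i\pi/3}$. Here an element of ${\rm SU}(3,1)$ is parabolic if it has no fixed point in complex hyperbolic 3-space ${\rm H}^3_{\mathbb C}$ and exactly one on its boundary at infinity, and boundary elliptic if it acts on ${\rm H}^3_{\mathbb C}$ as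 a non-identity isometry with a fixed point in ${\rm H}^3_{\mathbb C}$ and a fixed point on the boundary at infinity. -/

import Mathlib

open Matrix MeasureTheory
open scoped LinearAlgebra.Projectivization

noncomputable section

namespace FigureEight

/-! ### The figure-eight knot group -/

/-- The two generators of the figure-eight knot group (both are meridians of the knot). -/
inductive Gen
  | m
  | n

/-- The word `w = [n, m⁻¹] = n m⁻¹ n⁻¹ m` in the free group on the two generators. -/
def wordW : FreeGroup Gen :=
  FreeGroup.of Gen.n * (FreeGroup.of Gen.m)⁻¹ * (FreeGroup.of Gen.n)⁻¹ * FreeGroup.of Gen.m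

/-- The single relator `m w (w n)⁻¹`. -/
def relators : Set (FreeGroup Gen) :=
  {FreeGroup.of Gen.m * wordW * (wordW * FreeGroup.of Gen.n)⁻¹}

/-- The figure-eight knot group `Γ₈ = π₁(S³ ∖ K₈) = ⟨m, n | m w = w n⟩`, `w = [n, m⁻¹]`. -/
abbrev KnotGroup : Type := PresentedGroup relators

/-- The generator `m` of the figure-eight knot group. -/
def genM : KnotGroup := PresentedGroup.of Gen.m

/-- The generator `n` of the figure-eight knot group. -/
def genN : KnotGroup := PresentedGroup.of Gen.n

/-! ### The groups SO(3,1), SU(3,1) and SU(2,2) -/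

/-- `SL(4, 𝕜)`, with the topology induced from the space of matrices. -/
abbrev SL4 (𝕜 : Type) [RCLike 𝕜] : Type := Matrix.SpecialLinearGroup (Fin 4) 𝕜

/-- The subgroup of `SL(4, 𝕜)` preserving the sesquilinear form `(x, y) ↦ x* J y`. -/
def specialIsometries {𝕜 : Type} [RCLike 𝕜] (J : Matrix (Fin 4) (Fin 4) 𝕜) :
    Subgroup (SL4 𝕜) where
  carrier := {A | (A : Matrix (Fin 4) (Fin 4) 𝕜)ᴴ * J * (A : Matrix (Fin 4) (Fin 4) 𝕜) = J}
  one_mem' := by simp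
  mul_mem' := by
    intro A B (hA : A.1ᴴ * J * A.1 = J) (hB : B.1ᴴ * J * B.1 = J)
    change (A.1 * B.1)ᴴ * J * (A.1 * B.1) = J
    calc (A.1 * B.1)ᴴ * J * (A.1 * B.1) = B.1ᴴ * (A.1ᴴ * J * A.1) * B.1 := by
          simp only [conjTranspose_mul, Matrix.mul_assoc]
      _ = J := by rw [hA, hB]
  inv_mem' := by
    intro A (hA : A.1ᴴ * J * A.1 = J)
    change (A⁻¹).1ᴴ * J * (A⁻¹).1 = J
    have h : A.1 * (A⁻¹).1 = 1 := congrArg Subtype.val (mul_inv_cancel A)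
    calc (A⁻¹).1ᴴ * J * (A⁻¹).1 = (A⁻¹).1ᴴ * (A.1ᴴ * J * A.1) * (A⁻¹).1 := by rw [hA]
      _ = (A.1 * (A⁻¹).1)ᴴ * J * (A.1 * (A⁻¹).1) := by
          simp only [conjTranspose_mul, Matrix.mul_assoc]
      _ = J := by rw [h, conjTranspose_one, Matrix.one_mul, Matrix.mul_one]

/-- `SO(3,1)`: the real matrices of determinant one preserving `x₀² + x₁² + x₂² - x₃²`. -/
def SO31 : Subgroup (SL4 ℝ) := specialIsometries (diagonal ![1, 1, 1, -1])

/-- `SU(3,1)`: the complex matrices of determinant one preserving the Hermitian form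
`|z₀|² + |z₁|² + |z₂|² - |z₃|²`. -/
def SU31 : Subgroup (SL4 ℂ) := specialIsometries (diagonal ![1, 1, 1, -1])

/-- `SU(2,2)`: the complex matrices of determinant one preserving the Hermitian form
`|z₀|² + |z₁|² - |z₂|² - |z₃|²`. -/
def SU22 : Subgroup (SL4 ℂ) := specialIsometries (diagonal ![1, 1, -1, -1])

/-- The inclusion `SL(4, ℝ) → SL(4, ℂ)`. -/
def complexify : SL4 ℝ →* SL4 ℂ := SpecialLinearGroup.map Complex.ofRealHom

lemma complexify_mem {A : SL4 ℝ} (hA : A ∈ SO31) : complexify A ∈ SU31 := by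
  have h : (A : Matrix (Fin 4) (Fin 4) ℝ)ᴴ * diagonal ![1, 1, 1, -1] *
      (A : Matrix (Fin 4) (Fin 4) ℝ) = diagonal ![1, 1, 1, -1] := hA
  change ((A : Matrix (Fin 4) (Fin 4) ℝ).map Complex.ofRealHom)ᴴ * diagonal ![1, 1, 1, -1] *
      ((A : Matrix (Fin 4) (Fin 4) ℝ).map Complex.ofRealHom) = diagonal ![1, 1, 1, -1]
  have hJ : (diagonal ![1, 1, 1, -1] : Matrix (Fin 4) (Fin 4) ℂ) =
      (diagonal ![1, 1, 1, -1] : Matrix (Fin 4) (Fin 4) ℝ).map Complex.ofRealHom := by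
    ext i j
    fin_cases i <;> fin_cases j <;> simp [diagonal]
  have hT : ((A : Matrix (Fin 4) (Fin 4) ℝ).map Complex.ofRealHom)ᴴ =
      ((A : Matrix (Fin 4) (Fin 4) ℝ)ᴴ).map Complex.ofRealHom := by
    ext i j
    simp
  rw [hJ, hT, ← Matrix.map_mul, ← Matrix.map_mul, h]

/-- The inclusion `SO(3,1) → SU(3,1)`. -/
def SO31toSU31 : SO31 →* SU31 :=
  (complexify.comp SO31.subtype).codRestrict SU31 (fun A => complexify_mem A.2)

/-! ### Complex hyperbolic space and the types of its isometries -/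

/-- The Hermitian square `|z₀|² + |z₁|² + |z₂|² - |z₃|²`. -/
def hermSq (z : Fin 4 → ℂ) : ℝ := ‖z 0‖ ^ 2 + ‖z 1‖ ^ 2 + ‖z 2‖ ^ 2 - ‖z 3‖ ^ 2

/-- Complex hyperbolic 3-space: the negative lines in `ℂ^{3,1}`
(the sign of `hermSq` does not depend on the representative of a line). -/
def hyperbolicSpace : Set (ℙ ℂ (Fin 4 → ℂ)) := {p | hermSq p.rep < 0}

/-- The boundary at infinity of complex hyperbolic 3-space: the null lines. -/
def hyperbolicBoundary : Set (ℙ ℂ (Fin 4 → ℂ)) := {p | hermSq p.rep = 0}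

/-- `A` is parabolic: it has no fixed point in complex hyperbolic space and exactly one on the
boundary at infinity. -/
def IsParabolic (A : SU31) : Prop :=
  (∀ p ∈ hyperbolicSpace, (A : SL4 ℂ) • p ≠ p) ∧
    ∃! p, p ∈ hyperbolicBoundary ∧ (A : SL4 ℂ) • p = p

/-- `A` is boundary elliptic: it acts as a non-identity isometry with a fixed point in complex
hyperbolic space and a fixed point on the boundary at infinity. -/
def IsBoundaryElliptic (A : SU31) : Prop :=
  (∃ p : ℙ ℂ (Fin 4 → ℂ), (A : SL4 ℂ) • p ≠ p) ∧
    (∃ p ∈ hyperbolicSpace, (A : SL4 ℂ) • p = p) ∧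
      ∃ p ∈ hyperbolicBoundary, (A : SL4 ℂ) • p = p

/-- `σ` is parabolic-preserving, relative to the reference representation `σ₀` (by which `Γ` is
regarded as a group of isometries): `σ γ` is parabolic (resp. boundary elliptic) whenever `σ₀ γ`
is. -/
def IsParabolicPreserving {Γ : Type} [Group Γ] (σ₀ σ : Γ →* SU31) : Prop :=
  ∀ γ, (IsParabolic (σ₀ γ) → IsParabolic (σ γ)) ∧
    (IsBoundaryElliptic (σ₀ γ) → IsBoundaryElliptic (σ γ))

/-! ### Hyperbolic representations -/

/-- The point of the hyperboloid model
`H³ = {(x₀, x₁, x₂, t) | x₀² + x₁² + x₂² - t² = -1, t > 0}` above `x ∈ ℝ³`. -/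
def hyperboloidPoint (x : Fin 3 → ℝ) : Fin 4 → ℝ :=
  ![x 0, x 1, x 2, √(1 + x 0 ^ 2 + x 1 ^ 2 + x 2 ^ 2)]

/-- The hyperbolic volume of (the part of the hyperboloid above) a set `S ⊆ ℝ³`:
the hyperbolic volume element is `dx₀ dx₁ dx₂ / t`. -/
def hyperbolicVolume (S : Set (Fin 3 → ℝ)) : ENNReal :=
  ∫⁻ x in S, ENNReal.ofReal (1 / √(1 + x 0 ^ 2 + x 1 ^ 2 + x 2 ^ 2))

/-- `ρ : Γ₈ → SO(3,1)` is a hyperbolic representation, that is, the holonomy of a complete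
hyperbolic structure of finite volume: it takes its values in `SO⁰(3,1) = Isom⁺(H³)`
(it preserves the sheet `t > 0`), is faithful, and its image is a lattice, i.e. it is discrete and
a set of finite hyperbolic volume meets all of its orbits in `H³`.
By Mostow-Prasad rigidity such a `ρ` is unique up to conjugation by isometries of `H³`. -/
structure IsHyperbolicRep (ρ : KnotGroup →* SO31) : Prop where
  sheet : ∀ γ, 0 < ((ρ γ : SL4 ℝ) : Matrix (Fin 4) (Fin 4) ℝ) 3 3
  faithful : Function.Injective ρ
  discrete : DiscreteTopology ρ.range
  finite_covolume : ∃ S : Set (Fin 3 → ℝ), MeasurableSet S ∧ hyperbolicVolume S < ⊤ ∧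
    ∀ x : Fin 3 → ℝ, ∃ γ, ∃ y ∈ S,
      ((ρ γ : SL4 ℝ) : Matrix (Fin 4) (Fin 4) ℝ) *ᵥ hyperboloidPoint y = hyperboloidPoint x

/-! ### The explicit matrices -/

/-- The matrix `M_u`. -/
def matM (u : Circle) : Matrix (Fin 4) (Fin 4) ℂ :=
  !![1, 0, 1, (u : ℂ) / 2 - 1;
     0, 1, 1, (u : ℂ) / 2;
     0, 0, 1, ((u : ℂ) + 1) / 2;
     0, 0, 0, 1]

/-- The matrix `N_u`; for `u` of modulus one, `u⁻¹` is the complex conjugate of `u`. -/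
def matN (u : Circle) : Matrix (Fin 4) (Fin 4) ℂ :=
  !![1, 0, 0, 0;
     2 * (1 + (u : ℂ)⁻¹), 1, 0, 0;
     2, 1, 1, 0;
     1, 1, 0, 1]

/-- Two homomorphisms into a group `G` are conjugate in `G`. -/
def AreConjugate {Γ G : Type} [Group Γ] [Group G] (ρ₁ ρ₂ : Γ →* G) : Prop :=
  ∃ g : G, ∀ γ, ρ₂ γ = g * ρ₁ γ * g⁻¹

end FigureEight

end

/-!
In a suitable basis `ρ_u` has entries in `ℤ[u, u⁻¹]`. At the eight listed values of `u` this ring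
lies in the integers of an imaginary quadratic field, whose nonzero elements have norm at least
one, so the image is discrete. Away from `u = -1` the representation preserves a Hermitian form,
whose signature changes where `u² + u + 1 = 0`.

At `u = 1` the representation is the action on Hermitian `2 × 2` matrices of a representation into
`SL(2, ℤ[ω])`, with `ω = e^{2πi/3}`. It is faithful because the knot complement is glued from two
regular ideal tetrahedra: the group generated by the reflections in the faces of one of them acts
on the labelled tetrahedra of the tessellation, and by positivity of roots no nontrivial element
of this reflection group merely permutes the vertices of a tetrahedron. The orbits of a point of
hyperbolic space reach a definite height, because the unit isometric spheres centred at the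
Eisenstein integers cover the plane; this bounds a fundamental domain of finite volume.

For the last part, the Euclidean algorithm in `ℤ[ω]` shows that all cusps are equivalent, so that
every parabolic element has a power conjugate into the peripheral subgroup generated by the
meridian and the longitude. There the fixed vectors of `ρ_u`, and of its transpose, are explicit
and do not depend on the element, which makes the image parabolic. Boundary elliptic elements do
not occur: in a discrete group they are torsion, while the knot group, being a mapping torus of a
free group, is torsion-free.
-/

open scoped MatrixGroups

noncomputable section

namespace FigureEight

/-! ### Homomorphisms out of the figure-eight knot group -/

section Lift

variable {G : Type*} [Group G] {a b : G}

/-- The word `w` evaluated at `m = a`, `n = b`. -/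
def wordAt (a b : G) : G := b * a⁻¹ * b⁻¹ * a

/-- The homomorphism with prescribed values on the two meridians. -/
def liftHom (a b : G) (h : a * wordAt a b = wordAt a b * b) : KnotGroup →* G :=
  PresentedGroup.toGroup (f := fun | Gen.m => a | Gen.n => b) (by
    rintro _ rfl
    simp only [wordW, map_mul, map_inv, FreeGroup.lift_apply_of]
    exact mul_inv_eq_one.mpr h)

variable {h : a * wordAt a b = wordAt a b * b}

@[simp] lemma liftHom_genM : liftHom a b h genM = a := PresentedGroup.toGroup.of _

@[simp] lemma liftHom_genN : liftHom a b h genN = b := PresentedGroup.toGroup.of _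

end Lift

lemma genM_mul_wordAt : genM * wordAt genM genN = wordAt genM genN * genN := by
  have h : PresentedGroup.mk relators
      (FreeGroup.of Gen.m * wordW * (wordW * FreeGroup.of Gen.n)⁻¹) = 1 :=
    PresentedGroup.one_of_mem (Set.mem_singleton _)
  rw [map_mul, map_inv, mul_inv_eq_one] at h
  simp only [wordW, map_mul, map_inv] at h
  exact h

lemma closure_genM_genN : Subgroup.closure ({genM, genN} : Set KnotGroup) = ⊤ := by
  rw [eq_top_iff, ← PresentedGroup.closure_range_of, Subgroup.closure_le]
  rintro _ ⟨g, rfl⟩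
  cases g
  · exact Subgroup.subset_closure (Or.inl rfl)
  · exact Subgroup.subset_closure (Or.inr rfl)

lemma mem_of_genM_mem_of_genN_mem {S : Subgroup KnotGroup} (hm : genM ∈ S) (hn : genN ∈ S)
    (γ : KnotGroup) : γ ∈ S := by
  have hS : Subgroup.closure {genM, genN} ≤ S := by
    rw [Subgroup.closure_le]
    rintro _ (rfl | rfl) <;> assumption
  exact hS (closure_genM_genN ▸ Subgroup.mem_top γ)

lemma knotGroup_hom_ext {G : Type*} [Group G] {f g : KnotGroup →* G}
    (hm : f genM = g genM) (hn : f genN = g genN) : f = g :=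
  MonoidHom.ext (mem_of_genM_mem_of_genN_mem (S := f.eqLocus g) hm hn)

/-- The longitude of the knot, the element of the commutator subgroup which generates, together
with the meridian `m`, the peripheral subgroup. -/
def longitude : KnotGroup := wordAt genM genN * (genM * genN⁻¹ * genM⁻¹ * genN)

/-! ### The family of representations in an integral basis -/

lemma coe_inv_eq_of_mul_eq_one {n R : Type*} [DecidableEq n] [Fintype n] [CommRing R]
    {A : Matrix.SpecialLinearGroup n R} {B : Matrix n n R} (h : (A : Matrix n n R) * B = 1) :
    ((A⁻¹ : Matrix.SpecialLinearGroup n R) : Matrix n n R) = B :=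
  left_inv_eq_right_inv (congrArg Subtype.val (inv_mul_cancel A)) h

section IntegralRepresentation

variable {R : Type*} [CommRing R] (u : Rˣ)

/-- The image of `m` in the integral basis. -/
def intM : SL(4, R) :=
  ⟨!![1, 0, 1, (u : R); 0, 1, 0, 1; 0, 0, 1, u + 1; 0, 0, 0, 1], by
    simp [det_succ_row_zero, Fin.sum_univ_succ]⟩

/-- The image of `n` in the integral basis. -/
def intN : SL(4, R) :=
  ⟨!![1, 0, 0, 0; 1 + (↑u⁻¹ : R), 1, 0, 0; 1, 0, 1, 0; 1, 1, 0, 1], by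
    simp [det_succ_row_zero, Fin.sum_univ_succ]⟩

lemma coe_intM_inv : ((intM u)⁻¹).1 =
    !![1, 0, -1, 1; 0, 1, 0, -1; 0, 0, 1, -1 - (u : R); 0, 0, 0, 1] := by
  apply coe_inv_eq_of_mul_eq_one
  ext i j
  fin_cases i <;> fin_cases j <;> simp [intM, mul_apply, Fin.sum_univ_four] <;> ring

lemma coe_intN_inv : ((intN u)⁻¹).1 =
    !![1, 0, 0, 0; -1 - (↑u⁻¹ : R), 1, 0, 0; -1, 0, 1, 0; (↑u⁻¹ : R), -1, 0, 1] := by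
  apply coe_inv_eq_of_mul_eq_one
  ext i j
  fin_cases i <;> fin_cases j <;> simp [intN, mul_apply, Fin.sum_univ_four]
  ring

lemma coe_wordAt_intM_intN :
    (wordAt (intM u) (intN u)).1 =
      !![(↑u⁻¹ : R) + 2, -1, (↑u⁻¹ : R) + 1, u;
        (↑u⁻¹ : R) ^ 2 + (↑u⁻¹ : R) + 1, -(↑u⁻¹ : R) + 1, (↑u⁻¹ : R) ^ 2, 0;
        0, u, 0, 0;
        1, 0, 0, 0] := by
  have hu : (u : R) * (↑u⁻¹ : R) = 1 := u.mul_inv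
  simp only [wordAt, Matrix.SpecialLinearGroup.coe_mul, coe_intM_inv, coe_intN_inv]
  simp only [intM, intN]
  generalize (↑u⁻¹ : R) = v at *
  ext i j
  fin_cases i <;> fin_cases j <;> simp [mul_apply, Fin.sum_univ_four] <;> grind

lemma intM_mul_wordAt :
    intM u * wordAt (intM u) (intN u) = wordAt (intM u) (intN u) * intN u := by
  have hu : (u : R) * (↑u⁻¹ : R) = 1 := u.mul_inv
  apply Subtype.ext
  simp only [Matrix.SpecialLinearGroup.coe_mul, coe_wordAt_intM_intN]
  simp only [intM, intN]
  generalize (↑u⁻¹ : R) = v at *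
  ext i j
  fin_cases i <;> fin_cases j <;> simp [mul_apply, Fin.sum_univ_four] <;> grind

/-- The representation `ρ_u`, written in a basis in which its entries are in `ℤ[u, u⁻¹]`. -/
def intRep : KnotGroup →* SL(4, R) := liftHom _ _ (intM_mul_wordAt u)

@[simp] lemma intRep_genM : intRep u genM = intM u := liftHom_genM

@[simp] lemma intRep_genN : intRep u genN = intN u := liftHom_genN

lemma map_comp_intRep {S : Type*} [CommRing S] (f : R →+* S) :
    (Matrix.SpecialLinearGroup.map f).comp (intRep u) = intRep (Units.map (f : R →* S) u) := by
  apply knotGroup_hom_ext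
  · ext i j
    simp only [MonoidHom.comp_apply, intRep_genM]
    change f ((intM u).1 i j) = _
    fin_cases i <;> fin_cases j <;> simp [intM]
  · ext i j
    simp only [MonoidHom.comp_apply, intRep_genN]
    change f ((intN u).1 i j) = _
    fin_cases i <;> fin_cases j <;> simp [intN]

lemma coe_intRep_longitude :
    (intRep u longitude).1 =
      !![(u : R), (↑u⁻¹ : R) ^ 2 + (↑u⁻¹ : R) + 1 + u, -(↑u⁻¹ : R) ^ 2 - 1,
          (↑u⁻¹ : R) ^ 2 + 2 * (↑u⁻¹ : R) + 4 + 5 * u;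
        0, (↑u⁻¹ : R) ^ 3, -(↑u⁻¹ : R) ^ 3 + (↑u⁻¹ : R) ^ 2 - (↑u⁻¹ : R) + 1,
          (↑u⁻¹ : R) ^ 3 + (↑u⁻¹ : R) ^ 2 + 2 * (↑u⁻¹ : R) + 1 + u;
        0, 0, u, 0;
        0, 0, 0, u] := by
  have hu : (u : R) * (↑u⁻¹ : R) = 1 := u.mul_inv
  have hl : intRep u longitude =
      wordAt (intM u) (intN u) * (intM u * ((intN u)⁻¹ * ((intM u)⁻¹ * intN u))) := by
    simp [longitude, wordAt, mul_assoc]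
  rw [hl, Matrix.SpecialLinearGroup.coe_mul, coe_wordAt_intM_intN]
  simp only [Matrix.SpecialLinearGroup.coe_mul, coe_intM_inv, coe_intN_inv]
  simp only [intM, intN]
  generalize (↑u⁻¹ : R) = v at *
  ext i j
  fin_cases i <;> fin_cases j <;> simp [mul_apply, Fin.sum_univ_four] <;> grind

end IntegralRepresentation

/-! ### Conjugation and discreteness -/

section Conjugation

variable {n : Type*} [Fintype n] [DecidableEq n]

/-- Conjugation `A ↦ P A Q` by a matrix `P` of arbitrary determinant, with inverse `Q`. -/
def conjHom {R : Type*} [CommRing R] (P Q : Matrix n n R) (h : P * Q = 1) :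
    Matrix.SpecialLinearGroup n R →* Matrix.SpecialLinearGroup n R where
  toFun A := ⟨P * A.1 * Q, by rw [det_mul, det_mul, A.2, mul_one, ← det_mul, h, det_one]⟩
  map_one' := by
    apply Subtype.ext
    simp [h]
  map_mul' A B := by
    have hQP : Q * P = 1 := mul_eq_one_comm.mp h
    apply Subtype.ext
    calc P * (A.1 * B.1) * Q = P * A.1 * 1 * B.1 * Q := by simp only [mul_one, mul_assoc]
      _ = P * A.1 * Q * (P * B.1 * Q) := by rw [← hQP]; simp only [mul_assoc]

lemma coe_conjHom {R : Type*} [CommRing R] {P Q : Matrix n n R} (h : P * Q = 1)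
    (A : Matrix.SpecialLinearGroup n R) : (conjHom P Q h A).1 = P * A.1 * Q := rfl

lemma mul_conj_mul {R : Type*} [CommRing R] {P Q : Matrix n n R} (h : P * Q = 1)
    (A : Matrix n n R) : Q * (P * A * Q) * P = A := by
  have hQP : Q * P = 1 := mul_eq_one_comm.mp h
  calc Q * (P * A * Q) * P = (Q * P) * A * (Q * P) := by simp only [mul_assoc]
    _ = A := by rw [hQP, one_mul, mul_one]

lemma areConjugate_of_intertwining {n Γ K : Type} [Fintype n] [DecidableEq n] [Nonempty n]
    [Group Γ] [Field K] [IsAlgClosed K]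
    {ρ₁ ρ₂ : Γ →* Matrix.SpecialLinearGroup n K} {P Q : Matrix n n K} (h : P * Q = 1)
    (hP : ∀ γ, P * (ρ₁ γ).1 = (ρ₂ γ).1 * P) : AreConjugate ρ₁ ρ₂ := by
  have hP0 : P.det ≠ 0 := left_ne_zero_of_mul_eq_one (by rw [← det_mul, h, det_one])
  obtain ⟨c, hc⟩ := IsAlgClosed.exists_pow_nat_eq P.det⁻¹ (Fintype.card_pos (α := n))
  have hdet : (c • P).det = 1 := by rw [det_smul, hc, inv_mul_cancel₀ hP0]
  refine ⟨⟨c • P, hdet⟩, fun γ => eq_mul_inv_of_mul_eq (Subtype.ext ?_)⟩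
  change (ρ₂ γ).1 * (c • P) = (c • P) * (ρ₁ γ).1
  rw [Matrix.mul_smul, Matrix.smul_mul, hP]

end Conjugation

section AreConjugate

variable {Γ G : Type} [Group Γ] [Group G] {ρ₁ ρ₂ ρ₃ : Γ →* G}

lemma AreConjugate.symm (h : AreConjugate ρ₁ ρ₂) : AreConjugate ρ₂ ρ₁ := by
  obtain ⟨g, hg⟩ := h
  exact ⟨g⁻¹, fun γ => by rw [hg]; group⟩

lemma AreConjugate.trans (h : AreConjugate ρ₁ ρ₂) (h' : AreConjugate ρ₂ ρ₃) :
    AreConjugate ρ₁ ρ₃ := by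
  obtain ⟨g, hg⟩ := h
  obtain ⟨g', hg'⟩ := h'
  exact ⟨g' * g, fun γ => by rw [hg', hg]; group⟩

end AreConjugate

lemma discreteTopology_of_norm_sub_lt_one {X ι E : Type*} [TopologicalSpace X] [Finite ι]
    [SeminormedAddCommGroup E] {F : X → ι → E} (hF : Continuous F) (hinj : Function.Injective F)
    (hsep : ∀ x y i, ‖F x i - F y i‖ < 1 → F x i = F y i) : DiscreteTopology X := by
  rw [discreteTopology_iff_isOpen_singleton]
  intro x
  have hx : {x} = ⋂ i, {y | ‖F y i - F x i‖ < 1} := by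
    ext y
    simp only [Set.mem_singleton_iff, Set.mem_iInter, Set.mem_ofPred_eq]
    refine ⟨?_, fun hy => hinj (funext fun i => hsep y x i (hy i))⟩
    rintro rfl i
    simp
  rw [hx]
  refine isOpen_iInter_of_finite fun i => isOpen_lt ?_ continuous_const
  exact (((continuous_apply i).comp hF).sub continuous_const).norm

lemma discreteTopology_of_conj_entries {n K : Type*} [Fintype n] [DecidableEq n]
    [NormedCommRing K] {G : Subgroup (Matrix.SpecialLinearGroup n K)} {P Q : Matrix n n K}
    (h : P * Q = 1) {S : Set K} (hS : ∀ x ∈ S, ∀ y ∈ S, ‖x - y‖ < 1 → x = y)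
    (hG : ∀ A ∈ G, ∀ i j, (P * A.1 * Q) i j ∈ S) : DiscreteTopology G := by
  refine discreteTopology_of_norm_sub_lt_one
    (F := fun (A : G) (ij : n × n) => (P * A.1.1 * Q) ij.1 ij.2) ?_ ?_ ?_
  · have hcoe : Continuous fun A : G => A.1.1 := continuous_subtype_val.comp continuous_subtype_val
    have hconj : Continuous fun A : G => P * A.1.1 * Q :=
      (continuous_const.matrix_mul hcoe).matrix_mul continuous_const
    exact continuous_pi fun ij => hconj.matrix_elem ij.1 ij.2
  · intro A B hAB
    have hE : P * A.1.1 * Q = P * B.1.1 * Q := by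
      ext i j
      exact congrFun hAB (i, j)
    exact Subtype.ext (Subtype.ext 
      (calc A.1.1 = Q * (P * A.1.1 * Q) * P := (mul_conj_mul h _).symm
        _ = B.1.1 := by rw [hE, mul_conj_mul h]))
  · exact fun A B ij => hS _ (hG _ A.2 _ _) _ (hG _ B.2 _ _)

/-! ### The reflection group of the regular ideal tetrahedron -/

section Coxeter

variable {B W : Type*} [Group W] {M : CoxeterMatrix B} (cs : CoxeterSystem M W) {s t : B}

lemma exists_eq_simple_mul_of_isLeftDescent {w : W} (h : cs.IsLeftDescent w s) :
    ∃ v, w = cs.simple s * v ∧ cs.length w = cs.length v + 1 ∧ ¬cs.IsLeftDescent v s :=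
  ⟨cs.simple s * w, (cs.simple_mul_simple_cancel_left _).symm, (cs.isLeftDescent_iff.mp h).symm,
    cs.isLeftDescent_iff_not_isLeftDescent_mul.mp h⟩

lemma simple_braid (h : M s t = 3) :
    cs.simple s * cs.simple t * cs.simple s = cs.simple t * cs.simple s * cs.simple t := by
  have h3 := cs.simple_mul_simple_pow s t
  rw [h, pow_succ, pow_two] at h3
  calc cs.simple s * cs.simple t * cs.simple s
      = (cs.simple t * cs.simple s * cs.simple t)⁻¹ := by
        rw [eq_inv_iff_mul_eq_one, ← h3]
        simp only [mul_assoc]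
    _ = cs.simple t * cs.simple s * cs.simple t := by
        simp only [_root_.mul_inv_rev, cs.inv_simple, mul_assoc]

lemma not_isLeftDescent_of_length_simple_mul_simple_mul (h : M s t = 3) {x : W}
    (hs : ¬cs.IsLeftDescent (cs.simple t * (cs.simple s * x)) s)
    (hl : cs.length (cs.simple t * (cs.simple s * x)) = cs.length x + 2) :
    ¬cs.IsLeftDescent x t := by
  intro hx
  obtain ⟨y, rfl, hy, -⟩ := exists_eq_simple_mul_of_isLeftDescent cs hx
  have hbraid : cs.simple s * (cs.simple t * (cs.simple s * (cs.simple t * y))) =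
      cs.simple t * (cs.simple s * y) := by
    simp only [← mul_assoc, simple_braid cs h, cs.simple_mul_simple_cancel_right]
  have hlong := cs.not_isLeftDescent_iff.mp hs
  rw [hbraid, hl, hy] at hlong
  have h₁ := cs.length_mul_le (cs.simple t) (cs.simple s * y)
  have h₂ := cs.length_mul_le (cs.simple s) y
  rw [cs.length_simple] at h₁ h₂
  lia

end Coxeter

section SimplexGroup

variable (B : Type*) [DecidableEq B]

/-- The Coxeter matrix of a simplex with faces indexed by `B`, all of whose dihedral angles are
`π / 3`. For `B = Fin 4` this is the regular ideal tetrahedron. -/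
def simplexMatrix : CoxeterMatrix B where
  M := Matrix.of fun i j => if i = j then 1 else 3
  isSymm := by
    ext i j
    simp [eq_comm]
  diagonal := by simp
  off_diagonal := fun i j h => by simp [h]

/-- The group generated by the reflections in the faces of the simplex. -/
abbrev SimplexGroup : Type _ := (simplexMatrix B).Group

/-- The Coxeter system of the reflections in the faces of the simplex. -/
abbrev simplexSystem : CoxeterSystem (simplexMatrix B) (SimplexGroup B) :=
  (simplexMatrix B).toCoxeterSystem

variable {B}

lemma simplexMatrix_of_ne {i j : B} (h : i ≠ j) : simplexMatrix B i j = 3 := if_neg h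

/-- The reflection in the `i`-th face, in the basis of the vertices of the simplex. -/
def faceReflection (i : B) : Matrix B B ℤ :=
  Matrix.of fun k l => if l = i then (if k = i then -1 else 1) else if k = l then 1 else 0

variable [Fintype B]

lemma faceReflection_mul_apply (t s : B) (A : Matrix B B ℤ) (k : B) :
    (faceReflection t * A) s k = if s = t then -A t k else A s k + A t k := by
  have hrow : ∀ l, faceReflection t s l * A l k =
      (if l = t then (if s = t then -1 else 1) * A t k else 0) +
        (if l = s then (if s = t then 0 else A s k) else 0) := by
    intro l
    simp only [faceReflection, of_apply]
    grind
  rw [mul_apply, Finset.sum_congr rfl fun l _ => hrow l, Finset.sum_add_distrib,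
    Finset.sum_ite_eq' _ t, Finset.sum_ite_eq' _ s]
  split_ifs <;> simp_all [add_comm]

lemma faceReflection_liftable : (simplexMatrix B).IsLiftable faceReflection := by
  intro i j
  obtain rfl | h := eq_or_ne i j
  · rw [(simplexMatrix B).diagonal, pow_one]
    ext k l
    rw [faceReflection_mul_apply]
    simp only [faceReflection, of_apply, one_apply]
    grind
  · rw [simplexMatrix_of_ne h, ← mul_one ((faceReflection i * faceReflection j) ^ 3)]
    ext k l
    simp only [pow_succ, pow_zero, one_mul, mul_assoc, faceReflection_mul_apply]
    simp only [one_apply]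
    grind

/-- The linear representation of the reflection group of the simplex. -/
def simplexRep : SimplexGroup B →* Matrix B B ℤ :=
  (simplexSystem B).lift ⟨faceReflection, faceReflection_liftable⟩

lemma simplexRep_simple (i : B) : simplexRep ((simplexSystem B).simple i) = faceReflection i :=
  (simplexSystem B).lift_apply_simple faceReflection_liftable i

lemma simplexRep_simple_mul_self (t : B) (w : SimplexGroup B) (k : B) :
    simplexRep ((simplexSystem B).simple t * w) t k = -simplexRep w t k := by
  rw [map_mul, simplexRep_simple, faceReflection_mul_apply, if_pos rfl]

lemma simplexRep_simple_mul_of_ne {s t : B} (h : s ≠ t) (w : SimplexGroup B) (k : B) :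
    simplexRep ((simplexSystem B).simple t * w) s k = simplexRep w s k + simplexRep w t k := by
  rw [map_mul, simplexRep_simple, faceReflection_mul_apply, if_neg h]

/-- Positivity of roots: the rows of `simplexRep w` are roots of the Coxeter system. -/
lemma simplexRep_nonneg {w : SimplexGroup B} {s : B} (hs : ¬(simplexSystem B).IsLeftDescent w s)
    (k : B) : 0 ≤ simplexRep w s k := by
  induction hn : (simplexSystem B).length w using Nat.strong_induction_on generalizing w s with
  | _ n ih =>
  obtain rfl | hw := eq_or_ne w 1
  · rw [map_one, one_apply]
    split_ifs <;> norm_num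
  obtain ⟨t, ht⟩ := (simplexSystem B).exists_leftDescent_of_ne_one hw
  have hst : s ≠ t := fun h => hs (h ▸ ht)
  obtain ⟨v, rfl, hlv, hvt⟩ := exists_eq_simple_mul_of_isLeftDescent _ ht
  by_cases hvs : (simplexSystem B).IsLeftDescent v s
  · obtain ⟨x, rfl, hlx, -⟩ := exists_eq_simple_mul_of_isLeftDescent _ hvs
    have hxt : ¬(simplexSystem B).IsLeftDescent x t :=
      not_isLeftDescent_of_length_simple_mul_simple_mul _ (simplexMatrix_of_ne hst) hs (by lia)
    rw [simplexRep_simple_mul_of_ne hst, simplexRep_simple_mul_self,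
      simplexRep_simple_mul_of_ne hst.symm, add_comm, add_neg_cancel_right]
    exact ih _ (by lia) hxt rfl
  · rw [simplexRep_simple_mul_of_ne hst]
    exact add_nonneg (ih _ (by lia) hvs rfl) (ih _ (by lia) hvt rfl)

lemma eq_one_of_simplexRep_eq_perm {w : SimplexGroup B} {σ : Equiv.Perm B}
    (h : simplexRep w = (1 : Matrix B B ℤ).submatrix id σ) : w = 1 := by
  by_contra hw
  obtain ⟨t, ht⟩ := (simplexSystem B).exists_leftDescent_of_ne_one hw
  obtain ⟨v, rfl, -, hv⟩ := exists_eq_simple_mul_of_isLeftDescent _ ht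
  have hpos := simplexRep_nonneg hv (σ.symm t)
  have hneg : -simplexRep v t (σ.symm t) = 1 := by
    rw [← simplexRep_simple_mul_self, h]
    simp [one_apply]
  lia

end SimplexGroup

/-! ### The tessellation by regular ideal tetrahedra -/

/-- The element of the knot group leading from the `j`-th base tetrahedron across its face `f`. -/
def faceElt : Fin 2 → Fin 4 → KnotGroup :=
  ![![genN * genM * genN⁻¹, genM, 1, genM * genN⁻¹],
    ![genN * genM⁻¹, genN * genM⁻¹ * genN⁻¹, 1, genM⁻¹]]

/-- The identification of the vertices across the face `f` of the `j`-th base tetrahedron. -/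
def facePerm : Fin 2 → Fin 4 → Equiv.Perm (Fin 4) :=
  ![![⟨![1, 2, 0, 3], ![2, 0, 1, 3], by decide, by decide⟩,
      ⟨![0, 3, 1, 2], ![0, 2, 3, 1], by decide, by decide⟩,
      1,
      ⟨![3, 2, 1, 0], ![3, 2, 1, 0], by decide, by decide⟩],
    ![⟨![3, 2, 1, 0], ![3, 2, 1, 0], by decide, by decide⟩,
      ⟨![2, 0, 1, 3], ![1, 2, 0, 3], by decide, by decide⟩,
      1,
      ⟨![0, 2, 3, 1], ![0, 3, 1, 2], by decide, by decide⟩]]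

/-- The tetrahedra of the tessellation with a labelling of their vertices: a cell `(γ, j, σ)` is
the translate by `γ` of the `j`-th base tetrahedron, with vertices renamed by `σ`. -/
abbrev Cell : Type := KnotGroup × Fin 2 × Equiv.Perm (Fin 4)

/-- The cell across the face opposite to the vertex labelled `i`. -/
def cross (i : Fin 4) (y : Cell) : Cell :=
  (y.1 * faceElt y.2.1 (y.2.2 i), y.2.1 + 1, facePerm y.2.1 (y.2.2 i) * y.2.2)

/-- The element of the knot group leading from the `j`-th base tetrahedron across the faces `f`
and `f'`, a third of the turn around their common edge. -/
def edgeElt (j : Fin 2) (f f' : Fin 4) : KnotGroup :=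
  faceElt j f * faceElt (j + 1) (facePerm j f f')

/-- The permutation of the vertices which goes with `edgeElt`. -/
def edgePerm (j : Fin 2) (f f' : Fin 4) : Equiv.Perm (Fin 4) :=
  facePerm (j + 1) (facePerm j f f') * facePerm j f

lemma cross_cross_eq_edge (i k : Fin 4) (γ : KnotGroup) (j : Fin 2) (σ : Equiv.Perm (Fin 4)) :
    cross k (cross i (γ, j, σ)) =
      (γ * edgeElt j (σ i) (σ k), j, edgePerm j (σ i) (σ k) * σ) := by
  refine Prod.ext ?_ (Prod.ext ?_ ?_)
  · simp only [cross, edgeElt, Equiv.Perm.mul_apply, mul_assoc]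
  · change j + 1 + 1 = j
    revert j
    decide
  · simp only [cross, edgePerm, Equiv.Perm.mul_apply, mul_assoc]

lemma edgeElt_self (j : Fin 2) (f : Fin 4) : edgeElt j f f = 1 := by
  fin_cases j <;> fin_cases f <;> simp [edgeElt, faceElt, facePerm, mul_assoc]

lemma edgePerm_self (j : Fin 2) (f : Fin 4) : edgePerm j f f = 1 := by
  revert j f
  decide

lemma cross_cross (i : Fin 4) (y : Cell) : cross i (cross i y) = y := by
  obtain ⟨γ, j, σ⟩ := y
  rw [cross_cross_eq_edge, edgeElt_self, edgePerm_self, mul_one, one_mul]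

lemma edgePerm_cycle {j : Fin 2} {f f' : Fin 4} (h : f ≠ f') {p q r : Equiv.Perm (Fin 4)}
    (hp : p = edgePerm j f f') (hq : q = edgePerm j (p f) (p f'))
    (hr : r = edgePerm j (q (p f)) (q (p f'))) : r * q * p = 1 := by
  subst hp hq hr
  revert j f f'
  decide

/-- Each of the six edges gives the relator or its inverse, up to cyclic rotation. -/
lemma edgeElt_cycle {j : Fin 2} {f f' : Fin 4} (h : f ≠ f') {p q : Equiv.Perm (Fin 4)}
    (hp : p = edgePerm j f f') (hq : q = edgePerm j (p f) (p f')) :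
    edgeElt j f f' * edgeElt j (p f) (p f') * edgeElt j (q (p f)) (q (p f')) = 1 := by
  subst hp hq
  have relator : [genM, genN, genM⁻¹, genN⁻¹, genM, genN⁻¹, genM⁻¹, genN, genM, genN⁻¹].prod =
      1 := by
    simpa [wordAt, mul_assoc] using mul_inv_eq_one.mpr genM_mul_wordAt
  have relator_inv : [genN, genM⁻¹, genN⁻¹, genM, genN, genM⁻¹, genN, genM, genN⁻¹, genM⁻¹].prod =
      1 := by
    simpa [wordAt, mul_assoc] using mul_inv_eq_one.mpr genM_mul_wordAt.symm
  have rotations (k : Fin 10) := List.prod_rotate_eq_one_of_prod_eq_one relator k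
  have rotations_inv (k : Fin 10) := List.prod_rotate_eq_one_of_prod_eq_one relator_inv k
  rw [Fin.forall_fin_succ] at rotations rotations_inv
  simp [Fin.forall_fin_succ] at rotations rotations_inv
  fin_cases j <;> fin_cases f <;> fin_cases f' <;> first | exact absurd rfl h | skip
  all_goals simp [edgeElt, edgePerm, facePerm, faceElt, mul_assoc, rotations, rotations_inv]

lemma cross_cycle {i k : Fin 4} (h : i ≠ k) (y : Cell) :
    cross k (cross i (cross k (cross i (cross k (cross i y))))) = y := by
  obtain ⟨γ, j, σ⟩ := y
  have hσ : σ i ≠ σ k := fun e => h (σ.injective e)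
  simp only [cross_cross_eq_edge, Equiv.Perm.mul_apply]
  refine Prod.ext ?_ (Prod.ext rfl ?_)
  · simp only
    rw [mul_assoc, mul_assoc, ← mul_assoc (edgeElt _ _ _), edgeElt_cycle hσ rfl rfl, mul_one]
  · simp only
    rw [← mul_assoc, ← mul_assoc, edgePerm_cycle hσ rfl rfl rfl, one_mul]

lemma cross_liftable : (simplexMatrix (Fin 4)).IsLiftable
    (fun i => (MulOpposite.op (cross i) : (Function.End Cell)ᵐᵒᵖ)) := by
  intro i k
  obtain rfl | h := eq_or_ne i k
  · rw [(simplexMatrix (Fin 4)).diagonal, pow_one]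
    exact MulOpposite.unop_injective (funext (cross_cross i))
  · rw [simplexMatrix_of_ne h, pow_succ, pow_two]
    exact MulOpposite.unop_injective (funext (cross_cycle h))

/-- The right action of the reflection group on the cells. -/
def cellAction : SimplexGroup (Fin 4) →* (Function.End Cell)ᵐᵒᵖ :=
  (simplexSystem (Fin 4)).lift ⟨_, cross_liftable⟩

lemma cellAction_simple (i : Fin 4) (y : Cell) :
    (cellAction ((simplexSystem (Fin 4)).simple i)).unop y = cross i y := by
  rw [cellAction, (simplexSystem (Fin 4)).lift_apply_simple cross_liftable i]
  rfl

lemma cellAction_one (y : Cell) : (cellAction 1).unop y = y := by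
  rw [map_one]
  rfl

lemma cellAction_mul (w v : SimplexGroup (Fin 4)) (y : Cell) :
    (cellAction (w * v)).unop y = (cellAction v).unop ((cellAction w).unop y) := by
  rw [map_mul]
  rfl

/-- The vertices of the two base tetrahedra, as the columns of a matrix. -/
def baseVertices : Fin 2 → Matrix (Fin 4) (Fin 4) ℤ :=
  ![!![1, 0, 1, 1; 0, 0, 1, 2; 0, 0, 2, 1; 0, 1, 1, 1],
    !![1, 0, 1, 1; 0, 0, 1, 2; 0, 0, -1, 1; 0, 1, 1, 1]]

lemma isRegular_baseVertices_zero : IsRegular (baseVertices 0) := by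
  have hdet : (baseVertices 0).det ≠ 0 := by decide
  exact isRegular_of_isLeftRegular_det (IsRegular.of_ne_zero hdet).left

lemma baseVertices_mul_faceReflection (j : Fin 2) (f : Fin 4) :
    baseVertices j * faceReflection f =
      (intRep (1 : ℤˣ) (faceElt j f)).1 * (baseVertices (j + 1)).submatrix id (facePerm j f) := by
  fin_cases j <;> fin_cases f <;>
    simp only [faceElt, map_mul, map_inv, map_one, intRep_genM, intRep_genN,
      Matrix.SpecialLinearGroup.coe_mul,
      Matrix.SpecialLinearGroup.coe_one, Fin.mk_zero, Fin.mk_one, Fin.reduceFinMk, intM, intN,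
      cons_val, cons_val_zero, cons_val_one] <;>
    decide

/-- The vertices of a cell, as the columns of a matrix. -/
def cellVertices (y : Cell) : Matrix (Fin 4) (Fin 4) ℤ :=
  (intRep (1 : ℤˣ) y.1).1 * (baseVertices y.2.1).submatrix id y.2.2

lemma cellVertices_cross (i : Fin 4) (y : Cell) :
    cellVertices (cross i y) = cellVertices y * faceReflection i := by
  obtain ⟨γ, j, σ⟩ := y
  have hconj : faceReflection i = (faceReflection (σ i)).submatrix σ σ := by
    ext a b
    simp [faceReflection]
  have hbase : (baseVertices j).submatrix id σ * faceReflection i =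
      (baseVertices j * faceReflection (σ i)).submatrix id σ := by
    rw [hconj, ← submatrix_mul_equiv _ _ id σ σ]
  simp only [cellVertices, cross, map_mul, Matrix.SpecialLinearGroup.coe_mul]
  rw [mul_assoc, mul_assoc, hbase, baseVertices_mul_faceReflection]
  rfl

lemma cellVertices_cellAction (w : SimplexGroup (Fin 4)) (y : Cell) :
    cellVertices ((cellAction w).unop y) = cellVertices y * simplexRep w := by
  induction w using (simplexSystem (Fin 4)).simple_induction_right generalizing y with
  | one => rw [cellAction_one, map_one, mul_one]
  | mul_simple_right w i ih =>
    rw [cellAction_mul, cellAction_simple, cellVertices_cross, ih, map_mul, simplexRep_simple,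
      mul_assoc]

/-- From every translate `δ` of the base tetrahedron the reflection group leads to `δ * γ`. -/
def IsReachable (γ : KnotGroup) : Prop :=
  ∀ δ σ, ∃ (w : SimplexGroup (Fin 4)) (τ : Equiv.Perm (Fin 4)),
    (cellAction w).unop (δ, 0, σ) = (δ * γ, 0, τ)

lemma IsReachable.one : IsReachable 1 := fun δ σ => ⟨1, σ, by rw [cellAction_one, mul_one]⟩

lemma IsReachable.mul {a b : KnotGroup} (ha : IsReachable a) (hb : IsReachable b) :
    IsReachable (a * b) := by
  intro δ σ
  obtain ⟨w, τ, h⟩ := ha δ σ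
  obtain ⟨w', τ', h'⟩ := hb (δ * a) τ
  exact ⟨w * w', τ', by rw [cellAction_mul, h, h', mul_assoc]⟩

lemma isReachable_faceElt_mul_faceElt (f f' : Fin 4) :
    IsReachable (faceElt 0 f * faceElt 1 f') := by
  intro δ σ
  refine ⟨(simplexSystem (Fin 4)).simple (σ.symm f) *
    (simplexSystem (Fin 4)).simple ((facePerm 0 f * σ).symm f'),
    facePerm 1 f' * (facePerm 0 f * σ), ?_⟩
  rw [cellAction_mul, cellAction_simple, cellAction_simple]
  simp only [cross, Equiv.apply_symm_apply, zero_add, mul_assoc]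
  rfl

lemma isReachable (γ : KnotGroup) : IsReachable γ := by
  have hm : IsReachable genM := by simpa [faceElt] using isReachable_faceElt_mul_faceElt 1 2
  have hm' : IsReachable genM⁻¹ := by simpa [faceElt] using isReachable_faceElt_mul_faceElt 2 3
  have hn : IsReachable genN := by
    simpa [faceElt] using (isReachable_faceElt_mul_faceElt 2 0).mul hm
  have hn' : IsReachable genN⁻¹ := by
    simpa [faceElt] using hm'.mul (isReachable_faceElt_mul_faceElt 3 2)
  have hγ : γ ∈ Subgroup.closure {genM, genN} := closure_genM_genN ▸ Subgroup.mem_top γ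
  induction hγ using Subgroup.closure_induction'' with
  | mem x hx => obtain rfl | rfl := hx <;> assumption
  | inv_mem x hx => obtain rfl | rfl := hx <;> assumption
  | one => exact .one
  | mul x y _ _ hx hy => exact hx.mul hy

lemma intRep_one_injective : Function.Injective (intRep (1 : ℤˣ)) := by
  rw [injective_iff_map_eq_one]
  intro γ hγ
  obtain ⟨w, τ, hw⟩ := isReachable γ 1 1
  rw [one_mul] at hw
  have hvert : (baseVertices 0).submatrix id τ = baseVertices 0 * simplexRep w := by
    have h := cellVertices_cellAction w (1, 0, 1)
    rw [hw] at h
    simpa [cellVertices, hγ] using h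
  have hrep : simplexRep w = (1 : Matrix (Fin 4) (Fin 4) ℤ).submatrix id τ :=
    isRegular_baseVertices_zero.left (hvert.symm.trans (mul_submatrix_one (.refl _) τ _).symm)
  rw [eq_one_of_simplexRep_eq_perm hrep, cellAction_one] at hw
  exact (congrArg Prod.fst hw).symm

/-! ### The figure-eight knot group is torsion-free -/

lemma map_zpow_apply_eq_conj {F G : Type*} [Group F] [Group G] {f : F →* G} {α : MulAut F} {g : G}
    (h : ∀ x, f (α x) = g * f x * g⁻¹) (k : ℤ) (x : F) :
    f ((α ^ k) x) = g ^ k * f x * (g ^ k)⁻¹ := by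
  induction k using Int.induction_on generalizing x with
  | zero => simp
  | succ k ih =>
    rw [_root_.zpow_add_one, MulAut.mul_apply, ih, h, _root_.zpow_add_one]
    group
  | pred k ih =>
    have hinv := h (α⁻¹ x)
    rw [MulAut.apply_inv_self] at hinv
    rw [_root_.zpow_sub_one, MulAut.mul_apply, ih, _root_.zpow_sub_one, hinv]
    group

lemma semidirectProduct_eq_one_of_pow_eq_one {N G : Type*} [Group N] [Group G]
    {φ : G →* MulAut N} (hN : ∀ (x : N) (k : ℕ), k ≠ 0 → x ^ k = 1 → x = 1)
    (hG : ∀ (g : G) (k : ℕ), k ≠ 0 → g ^ k = 1 → g = 1) {x : N ⋊[φ] G} {k : ℕ} (hk : k ≠ 0)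
    (h : x ^ k = 1) : x = 1 := by
  have hright : x.right = 1 := hG _ k hk (by
    rw [← SemidirectProduct.rightHom_eq_right, ← map_pow, h, map_one])
  have hx : x = SemidirectProduct.inl x.left := SemidirectProduct.ext rfl (by simp [hright])
  rw [hx, ← map_pow] at h
  have hleft : x.left = 1 :=
    hN _ k hk (SemidirectProduct.inl_injective (h.trans (map_one _).symm))
  rw [hx, hleft, map_one]

/-- The free group of rank two, the fundamental group of the fibre of the knot complement. -/
abbrev FiberGroup : Type := FreeGroup (Fin 2)

/-- The endomorphism of the free group with given values on the generators. -/
def fiberHom {G : Type*} [Group G] (a b : G) : FiberGroup →* G := FreeGroup.lift ![a, b]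

@[simp] lemma fiberHom_zero {G : Type*} [Group G] (a b : G) :
    fiberHom a b (FreeGroup.of 0) = a := by simp [fiberHom]

@[simp] lemma fiberHom_one {G : Type*} [Group G] (a b : G) :
    fiberHom a b (FreeGroup.of 1) = b := by simp [fiberHom]

lemma fiberHom_ext {G : Type*} [Group G] {f g : FiberGroup →* G}
    (h0 : f (FreeGroup.of 0) = g (FreeGroup.of 0))
    (h1 : f (FreeGroup.of 1) = g (FreeGroup.of 1)) : f = g :=
  FreeGroup.ext_hom _ _ (Fin.forall_fin_two.mpr ⟨h0, h1⟩)

/-- The monodromy of the fibration of the figure-eight knot complement. -/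
def monodromy : MulAut FiberGroup :=
  MonoidHom.toMulEquiv
    (fiberHom (FreeGroup.of 1)
      (FreeGroup.of 1 * (FreeGroup.of 0)⁻¹ * FreeGroup.of 1 * FreeGroup.of 1))
    (fiberHom (FreeGroup.of 0 * FreeGroup.of 0 * (FreeGroup.of 1)⁻¹ * FreeGroup.of 0)
      (FreeGroup.of 0))
    (by apply fiberHom_ext <;> simp [mul_assoc])
    (by apply fiberHom_ext <;> simp [mul_assoc])

lemma monodromy_zero : monodromy (FreeGroup.of 0) = FreeGroup.of 1 := by
  rw [monodromy, MonoidHom.toMulEquiv_apply]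
  exact fiberHom_zero _ _

lemma monodromy_one : monodromy (FreeGroup.of 1) =
    FreeGroup.of 1 * (FreeGroup.of 0)⁻¹ * FreeGroup.of 1 * FreeGroup.of 1 := by
  rw [monodromy, MonoidHom.toMulEquiv_apply]
  exact fiberHom_one _ _

/-- The mapping torus of the monodromy. -/
abbrev MappingTorus : Type :=
  FiberGroup ⋊[zpowersHom (MulAut FiberGroup) monodromy] Multiplicative ℤ

/-- The generator of the base of the mapping torus. -/
def torusBase : MappingTorus := SemidirectProduct.inr (Multiplicative.ofAdd 1)

/-- The inclusion of the fibre. -/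
def torusFiber : FiberGroup →* MappingTorus := SemidirectProduct.inl

lemma torusBase_conj (x : FiberGroup) :
    torusBase * torusFiber x * torusBase⁻¹ = torusFiber (monodromy x) := by
  have h := SemidirectProduct.inl_aut (φ := zpowersHom (MulAut FiberGroup) monodromy)
    (Multiplicative.ofAdd 1) x
  rw [zpowersHom_apply, toAdd_ofAdd, zpow_one, map_inv] at h
  exact h.symm

lemma mul_wordAt_eq_wordAt_mul_iff {G : Type*} [Group G] {t a b : G} (h : t * a * t⁻¹ = b) :
    t * wordAt t (b * t) = wordAt t (b * t) * (b * t) ↔ t * b * t⁻¹ = b * a⁻¹ * b * b := by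
  have hL : t * wordAt t (b * t) = (t * b * t⁻¹) * b⁻¹ * t := by
    simp only [wordAt]
    group
  have hR : wordAt t (b * t) * (b * t) = b * a⁻¹ * b * t := by
    simp only [wordAt, ← h]
    group
  rw [hL, hR, mul_left_inj, mul_inv_eq_iff_eq_mul]

lemma torusBase_mul_wordAt :
    torusBase * wordAt torusBase (torusFiber (FreeGroup.of 1) * torusBase) =
      wordAt torusBase (torusFiber (FreeGroup.of 1) * torusBase) *
        (torusFiber (FreeGroup.of 1) * torusBase) := by
  rw [mul_wordAt_eq_wordAt_mul_iff (a := torusFiber (FreeGroup.of 0)), torusBase_conj,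
    monodromy_one]
  · simp only [map_mul, map_inv]
  · rw [torusBase_conj, monodromy_zero]

/-- The homomorphism from the knot group to the mapping torus. -/
def toTorus : KnotGroup →* MappingTorus := liftHom _ _ torusBase_mul_wordAt

/-- The inclusion of the fibre group in the knot group. -/
def fiberInclusion : FiberGroup →* KnotGroup := fiberHom (genM⁻¹ * genN) (genN * genM⁻¹)

lemma fiberInclusion_monodromy (x : FiberGroup) :
    fiberInclusion (monodromy x) = genM * fiberInclusion x * genM⁻¹ := by
  have h0 : genM * (genM⁻¹ * genN) * genM⁻¹ = genN * genM⁻¹ := by group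
  have h1 : genM * (genN * genM⁻¹) * genM⁻¹ =
      genN * genM⁻¹ * (genM⁻¹ * genN)⁻¹ * (genN * genM⁻¹) * (genN * genM⁻¹) := by
    refine (mul_wordAt_eq_wordAt_mul_iff h0).mp ?_
    simpa using genM_mul_wordAt
  have h : fiberInclusion.comp monodromy.toMonoidHom =
      (MulAut.conj genM).toMonoidHom.comp fiberInclusion := by
    apply fiberHom_ext
    · simp [monodromy_zero, fiberInclusion]
    · change fiberInclusion (monodromy (FreeGroup.of 1)) =
        genM * fiberInclusion (FreeGroup.of 1) * genM⁻¹
      simp only [fiberInclusion, monodromy_one, map_mul, map_inv, fiberHom_zero, fiberHom_one]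
      exact h1.symm
  exact DFunLike.congr_fun h x

/-- The homomorphism from the mapping torus to the knot group. -/
def ofTorus : MappingTorus →* KnotGroup :=
  SemidirectProduct.lift fiberInclusion (zpowersHom _ genM) fun k =>
    MonoidHom.ext (map_zpow_apply_eq_conj fiberInclusion_monodromy k.toAdd)

lemma ofTorus_toTorus (γ : KnotGroup) : ofTorus (toTorus γ) = γ := by
  have h : ofTorus.comp toTorus = MonoidHom.id KnotGroup := by
    apply knotGroup_hom_ext <;>
      simp [ofTorus, toTorus, torusBase, torusFiber, fiberInclusion]
  exact DFunLike.congr_fun h γ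

lemma knotGroup_torsionFree {γ : KnotGroup} {k : ℕ} (hk : k ≠ 0) (h : γ ^ k = 1) : γ = 1 := by
  have ht : toTorus γ = 1 := semidirectProduct_eq_one_of_pow_eq_one
    (fun _ _ hk => (pow_eq_one_iff_left hk).mp) (fun _ _ hk => (pow_eq_one_iff_left hk).mp) hk
    (by rw [← map_pow, h, map_one])
  rw [← ofTorus_toTorus γ, ht, map_one]

/-! ### Discrete quadratic rings -/

/-- The ring `ℤ[τ]`, where `τ` is a root of `X² + c X + 1`. -/
def quadRing (τ : ℂ) (c : ℤ) (h : τ * τ = -(c : ℂ) * τ - 1) : Subring ℂ where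
  carrier := {z | ∃ a b : ℤ, z = a + b * τ}
  one_mem' := ⟨1, 0, by simp⟩
  zero_mem' := ⟨0, 0, by simp⟩
  add_mem' := by
    rintro _ _ ⟨a, b, rfl⟩ ⟨a', b', rfl⟩
    exact ⟨a + a', b + b', by push_cast; ring⟩
  neg_mem' := by
    rintro _ ⟨a, b, rfl⟩
    exact ⟨-a, -b, by push_cast; ring⟩
  mul_mem' := by
    rintro _ _ ⟨a, b, rfl⟩ ⟨a', b', rfl⟩
    exact ⟨a * a' - b * b', a * b' + b * a' - c * b * b', by
      push_cast
      linear_combination (b : ℂ) * b' * h⟩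

section
variable {τ : ℂ} {c : ℤ} {h : τ * τ = -(c : ℂ) * τ - 1}

lemma self_mem_quadRing : τ ∈ quadRing τ c h := ⟨0, 1, by simp⟩

lemma conj_mem_quadRing (hc : star τ = -(c : ℂ) - τ) {z : ℂ} (hz : z ∈ quadRing τ c h) :
    star z ∈ quadRing τ c h := by
  obtain ⟨a, b, rfl⟩ := hz
  exact ⟨a - b * c, -b, by simp only [star_add, star_mul', star_intCast, hc]; push_cast; ring⟩

lemma normSq_quadRing (hc : star τ = -(c : ℂ) - τ) {z : ℂ} (hz : z ∈ quadRing τ c h) :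
    ∃ k : ℕ, ‖z‖ ^ 2 = k := by
  obtain ⟨a, b, rfl⟩ := hz
  have h1 : ((‖(a + b * τ : ℂ)‖ ^ 2 : ℝ) : ℂ) = ((a ^ 2 - c * a * b + b ^ 2 : ℤ) : ℂ) := by
    rw [Complex.ofReal_pow, ← Complex.mul_conj']
    change _ * star (a + b * τ : ℂ) = _
    simp only [star_add, star_mul', star_intCast, hc]
    push_cast
    linear_combination -(b : ℂ) ^ 2 * h
  have h2 : ‖(a + b * τ : ℂ)‖ ^ 2 = ((a ^ 2 - c * a * b + b ^ 2 : ℤ) : ℝ) := by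
    exact_mod_cast h1
  have h3 : 0 ≤ a ^ 2 - c * a * b + b ^ 2 := by
    have : (0 : ℝ) ≤ ((a ^ 2 - c * a * b + b ^ 2 : ℤ) : ℝ) := h2 ▸ sq_nonneg _
    exact_mod_cast this
  refine ⟨(a ^ 2 - c * a * b + b ^ 2).toNat, h2.trans ?_⟩
  rw [← Int.cast_natCast, Int.toNat_of_nonneg h3]

lemma one_le_norm_quadRing (hc : star τ = -(c : ℂ) - τ) {z : ℂ} (hz : z ∈ quadRing τ c h)
    (h0 : z ≠ 0) : 1 ≤ ‖z‖ := by
  obtain ⟨k, hk⟩ := normSq_quadRing hc hz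
  have hpos : 0 < ‖z‖ ^ 2 := by positivity
  rw [hk] at hpos
  have : (1 : ℝ) ≤ k := by exact_mod_cast (Nat.cast_pos.mp hpos)
  rw [← hk] at this
  exact (one_le_sq_iff₀ (norm_nonneg z)).mp this

end

/-! ### The Eisenstein integers -/

/-- The primitive cube root of unity `e^{2πi/3}`. -/
def omega : ℂ := ⟨-1 / 2, √3 / 2⟩

lemma sqrt_three_mul_self : √3 * √3 = 3 := Real.mul_self_sqrt (by norm_num)

lemma omega_mul_self : omega * omega = -omega - 1 := by
  have h3 := sqrt_three_mul_self
  apply Complex.ext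
  · simp [omega]
    nlinarith
  · simp [omega]
    ring

lemma star_omega : star omega = -1 - omega := by
  apply Complex.ext
  · simp [omega]
    norm_num
  · simp [omega]

/-- The ring of Eisenstein integers. -/
abbrev eisenstein : Subring ℂ := quadRing omega 1 (by simpa using omega_mul_self)

lemma star_omega_eq_neg_intCast_sub : star omega = -((1 : ℤ) : ℂ) - omega := by
  simpa using star_omega

lemma norm_omega : ‖omega‖ = 1 := by
  have h : (((‖omega‖ ^ 2 : ℝ)) : ℂ) = 1 := by
    rw [Complex.ofReal_pow, ← Complex.mul_conj', starRingEnd_apply, star_omega]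
    linear_combination -omega_mul_self
  exact (pow_eq_one_iff_of_nonneg (norm_nonneg _) two_ne_zero).mp (by exact_mod_cast h)

lemma norm_one_add_omega : ‖1 + omega‖ = 1 := by
  rw [show 1 + omega = -star omega by rw [star_omega]; ring, norm_neg, norm_star, norm_omega]

lemma exists_norm_sub_eisenstein_sq_le (z : ℂ) :
    ∃ x y : ℤ, ‖z - (x + y * omega)‖ ^ 2 ≤ 7 / 16 := by
  set y : ℤ := round (2 * z.im / √3)
  set x : ℤ := round (z.re + y / 2)
  refine ⟨x, y, ?_⟩
  have hy : (2 * z.im / √3 - y) ^ 2 ≤ (1 / 2) ^ 2 :=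
    sq_le_sq' (abs_le.mp (abs_sub_round _)).1 (abs_le.mp (abs_sub_round _)).2
  have hx : (z.re + y / 2 - x) ^ 2 ≤ (1 / 2) ^ 2 :=
    sq_le_sq' (abs_le.mp (abs_sub_round _)).1 (abs_le.mp (abs_sub_round _)).2
  have him : z.im - y * (√3 / 2) = (√3 / 2) * (2 * z.im / √3 - y) := by
    field_simp
  calc ‖z - (x + y * omega)‖ ^ 2
      = (z.re + y / 2 - x) ^ 2 + (z.im - y * (√3 / 2)) ^ 2 := by
        rw [Complex.sq_norm, Complex.normSq_apply]
        simp [omega]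
        ring
    _ = (z.re + y / 2 - x) ^ 2 + (√3 * √3) / 4 * (2 * z.im / √3 - y) ^ 2 := by
        rw [him]
        ring
    _ ≤ 7 / 16 := by rw [sqrt_three_mul_self]; linarith

/-! ### The representation into `SL(2, ℂ)` -/

/-- The image of the meridian `m` under the holonomy `slRep` in `SL(2, ℂ)`. -/
def slM : SL(2, ℂ) := ⟨!![1, 1; 0, 1], by simp [det_fin_two]⟩

/-- The image of the meridian `n` under the holonomy `slRep` in `SL(2, ℂ)`. -/
def slN : SL(2, ℂ) := ⟨!![1, 0; -omega, 1], by simp [det_fin_two]⟩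

lemma coe_slM_inv : (slM⁻¹).1 = !![1, -1; 0, 1] := by
  rw [Matrix.SpecialLinearGroup.coe_inv]
  simp [slM, adjugate_fin_two]

lemma coe_slN_inv : (slN⁻¹).1 = !![1, 0; omega, 1] := by
  rw [Matrix.SpecialLinearGroup.coe_inv]
  simp [slN, adjugate_fin_two]

lemma slM_mul_wordAt : slM * wordAt slM slN = wordAt slM slN * slN := by
  apply Subtype.ext
  simp only [wordAt, Matrix.SpecialLinearGroup.coe_mul, coe_slM_inv, coe_slN_inv]
  have h := omega_mul_self
  simp only [slM, slN]
  ext i j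
  fin_cases i <;> fin_cases j <;> simp [mul_apply, Fin.sum_univ_two] <;> grind

/-- The discrete faithful representation of the knot group into `SL(2, ℂ)`. -/
def slRep : KnotGroup →* SL(2, ℂ) := liftHom _ _ slM_mul_wordAt

@[simp] lemma slRep_genM : slRep genM = slM := liftHom_genM

@[simp] lemma slRep_genN : slRep genN = slN := liftHom_genN

lemma slRep_mem_eisenstein (γ : KnotGroup) (i j : Fin 2) : (slRep γ).1 i j ∈ eisenstein := by
  have h : γ ∈ (SpecialLinearGroup.map eisenstein.subtype).range.comap slRep := by
    refine mem_of_genM_mem_of_genN_mem ?_ ?_ γ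
    · refine ⟨⟨!![1, 1; 0, 1], by simp [det_fin_two]⟩, Subtype.ext ?_⟩
      rw [slRep_genM]
      ext i j
      fin_cases i <;> fin_cases j <;> rfl
    · refine ⟨⟨!![1, 0; ⟨-omega, neg_mem self_mem_quadRing⟩, 1], by simp [det_fin_two]⟩,
        Subtype.ext ?_⟩
      rw [slRep_genN]
      ext i j
      fin_cases i <;> fin_cases j <;> rfl
  obtain ⟨A, hA⟩ := h
  rw [← hA]
  exact (A.1 i j).2

/-- `A` acts on the Riemann sphere as the translation by `τ`. -/
def IsTranslation (A : SL(2, ℂ)) (τ : ℂ) : Prop := ∃ s : ℂ, s * s = 1 ∧ A.1 = !![s, s * τ; 0, s]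

lemma IsTranslation.mul {A B : SL(2, ℂ)} {τ τ' : ℂ} (hA : IsTranslation A τ)
    (hB : IsTranslation B τ') : IsTranslation (A * B) (τ + τ') := by
  obtain ⟨s, hs, hA⟩ := hA
  obtain ⟨t, ht, hB⟩ := hB
  refine ⟨s * t, by linear_combination t * t * hs + ht, ?_⟩
  rw [Matrix.SpecialLinearGroup.coe_mul, hA, hB]
  ext i j
  fin_cases i <;> fin_cases j <;> simp [mul_apply, Fin.sum_univ_two]
  ring

lemma IsTranslation.inv {A : SL(2, ℂ)} {τ : ℂ} (hA : IsTranslation A τ) :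
    IsTranslation A⁻¹ (-τ) := by
  obtain ⟨s, hs, hA⟩ := hA
  refine ⟨s, hs, ?_⟩
  rw [Matrix.SpecialLinearGroup.coe_inv, hA, adjugate_fin_two]
  simp

lemma isTranslation_one : IsTranslation 1 0 :=
  ⟨1, one_mul 1, by rw [Matrix.SpecialLinearGroup.coe_one, one_fin_two]; simp⟩

lemma IsTranslation.zpow {A : SL(2, ℂ)} {τ : ℂ} (hA : IsTranslation A τ) (k : ℤ) :
    IsTranslation (A ^ k) (k * τ) := by
  induction k using Int.induction_on with
  | zero => simpa using isTranslation_one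
  | succ k ih =>
    rw [_root_.zpow_add_one]
    convert ih.mul hA using 1
    push_cast
    ring
  | pred k ih =>
    rw [_root_.zpow_sub_one]
    convert ih.mul hA.inv using 1
    push_cast
    ring

lemma isTranslation_genM : IsTranslation (slRep genM) 1 :=
  ⟨1, one_mul 1, by rw [slRep_genM]; simp [slM]⟩

lemma isTranslation_longitude : IsTranslation (slRep longitude) (2 + 4 * omega) := by
  refine ⟨-1, by norm_num, ?_⟩
  simp only [longitude, wordAt, map_mul, map_inv, slRep_genM, slRep_genN,
    Matrix.SpecialLinearGroup.coe_mul, coe_slM_inv, coe_slN_inv]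
  have h := omega_mul_self
  simp only [slM, slN]
  ext i j
  fin_cases i <;> fin_cases j <;> simp [mul_apply, Fin.sum_univ_two] <;> grind

lemma isTranslation_peripheral (a b : ℤ) :
    IsTranslation (slRep (genM ^ a * longitude ^ b)) (a + b * (2 + 4 * omega)) := by
  rw [map_mul, map_zpow, map_zpow]
  simpa using (isTranslation_genM.zpow a).mul (isTranslation_longitude.zpow b)

/-- The isometric sphere of some element of the knot group is a unit disc centred at `q`. -/
def IsFullCenter (q : ℂ) : Prop :=
  ∃ γ, ‖(slRep γ).1 1 0‖ = 1 ∧ (slRep γ).1 1 1 = -((slRep γ).1 1 0 * q)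

lemma IsFullCenter.sub {q τ : ℂ} (hq : IsFullCenter q) {δ : KnotGroup}
    (hδ : IsTranslation (slRep δ) τ) : IsFullCenter (q - τ) := by
  obtain ⟨γ, h1, h2⟩ := hq
  obtain ⟨s, hs, hA⟩ := hδ
  have hs1 : ‖s‖ = 1 := by rcases mul_self_eq_one_iff.mp hs with rfl | rfl <;> simp
  have e0 : (slRep (γ * δ)).1 1 0 = (slRep γ).1 1 0 * s := by
    rw [map_mul, Matrix.SpecialLinearGroup.coe_mul, hA]
    simp [mul_apply, Fin.sum_univ_two]
  have e1 : (slRep (γ * δ)).1 1 1 = (slRep γ).1 1 0 * (s * τ) + (slRep γ).1 1 1 * s := by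
    rw [map_mul, Matrix.SpecialLinearGroup.coe_mul, hA]
    simp [mul_apply, Fin.sum_univ_two]
  refine ⟨γ * δ, ?_, ?_⟩
  · rw [e0, norm_mul, h1, hs1, one_mul]
  · rw [e1, e0, h2]
    ring

lemma isFullCenter_neg_one_sub_omega : IsFullCenter (-1 - omega) := by
  refine ⟨genN, ?_, ?_⟩ <;> rw [slRep_genN]
  · simp [slN, norm_omega]
  · simp only [slN, of_apply, cons_val', cons_val_zero, cons_val_one, cons_val_fin_one]
    linear_combination omega_mul_self

lemma isFullCenter_one : IsFullCenter 1 := by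
  have h : (slRep (genN * genM⁻¹ * genN⁻¹)).1 =
      !![1 - omega, -1; -(1 + omega), 1 + omega] := by
    have hω := omega_mul_self
    simp only [map_mul, map_inv, slRep_genM, slRep_genN, Matrix.SpecialLinearGroup.coe_mul,
      coe_slM_inv, coe_slN_inv]
    simp only [slN]
    ext i j
    fin_cases i <;> fin_cases j <;> simp [mul_apply, Fin.sum_univ_two] <;> grind
  refine ⟨genN * genM⁻¹ * genN⁻¹, ?_, ?_⟩ <;>
    simp only [h, of_apply, cons_val', cons_val_zero, cons_val_one, cons_val_fin_one]
  · rw [norm_neg, norm_one_add_omega]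
  · ring

lemma isFullCenter_one_add_omega : IsFullCenter (1 + omega) := by
  refine ⟨genN⁻¹, ?_, ?_⟩ <;> rw [map_inv, slRep_genN, coe_slN_inv]
  · simp [norm_omega]
  · simp only [of_apply, cons_val', cons_val_zero, cons_val_one, cons_val_fin_one]
    linear_combination omega_mul_self

lemma isFullCenter_one_add_two_mul_omega : IsFullCenter (1 + 2 * omega) := by
  have h : (slRep (genN * genM * genN⁻¹)).1 = !![1 + omega, 1; 1 + omega, 1 - omega] := by
    have hω := omega_mul_self
    simp only [map_mul, map_inv, slRep_genM, slRep_genN, Matrix.SpecialLinearGroup.coe_mul,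
      coe_slN_inv]
    simp only [slM, slN]
    ext i j
    fin_cases i <;> fin_cases j <;> simp [mul_apply, Fin.sum_univ_two] <;> grind
  refine ⟨genN * genM * genN⁻¹, ?_, ?_⟩ <;>
    simp only [h, of_apply, cons_val', cons_val_zero, cons_val_one, cons_val_fin_one]
  · exact norm_one_add_omega
  · linear_combination 2 * omega_mul_self

lemma exists_isFullCenter_add_mul_omega {r : ℤ} (h1 : -1 ≤ r) (h2 : r ≤ 2) :
    ∃ x : ℤ, IsFullCenter (x + r * omega) := by
  have hr : r = -1 ∨ r = 0 ∨ r = 1 ∨ r = 2 := by omega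
  rcases hr with rfl | rfl | rfl | rfl
  · exact ⟨-1, by simpa [sub_eq_add_neg] using isFullCenter_neg_one_sub_omega⟩
  · exact ⟨1, by simpa using isFullCenter_one⟩
  · exact ⟨1, by simpa using isFullCenter_one_add_omega⟩
  · exact ⟨1, by simpa using isFullCenter_one_add_two_mul_omega⟩

lemma isFullCenter_eisenstein (x y : ℤ) : IsFullCenter (x + y * omega) := by
  -- `1` and `2 + 4ω` are translations, so only the residue of `y` modulo four matters.
  obtain ⟨x', hx'⟩ :=
    exists_isFullCenter_add_mul_omega (r := y - 4 * ((y + 1) / 4)) (by omega) (by omega)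
  have := hx'.sub (isTranslation_peripheral (x' - x + 2 * ((y + 1) / 4)) (-((y + 1) / 4)))
  convert this using 1
  push_cast
  ring

lemma exists_isometricSphere (z : ℂ) :
    ∃ γ, ‖(slRep γ).1 1 0‖ = 1 ∧ ‖(slRep γ).1 1 0 * z + (slRep γ).1 1 1‖ ^ 2 ≤ 7 / 16 := by
  obtain ⟨x, y, hxy⟩ := exists_norm_sub_eisenstein_sq_le z
  obtain ⟨γ, hnorm, hcenter⟩ := isFullCenter_eisenstein x y
  refine ⟨γ, hnorm, ?_⟩
  have h : (slRep γ).1 1 0 * z + (slRep γ).1 1 1 =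
      (slRep γ).1 1 0 * (z - (x + y * omega)) := by
    rw [hcenter]
    ring
  rwa [h, norm_mul, hnorm, one_mul]

/-! ### Invariant forms and unitary representations -/

section
variable {K : Type} [RCLike K]

lemma mem_specialIsometries {J : Matrix (Fin 4) (Fin 4) K} {A : SL4 K} :
    A ∈ specialIsometries J ↔ A.1ᴴ * J * A.1 = J := Iff.rfl

lemma intRep_mem_specialIsometries {u : Kˣ} {H : Matrix (Fin 4) (Fin 4) K}
    (hM : intM u ∈ specialIsometries H) (hN : intN u ∈ specialIsometries H) (γ : KnotGroup) :
    intRep u γ ∈ specialIsometries H :=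
  mem_of_genM_mem_of_genN_mem (S := (specialIsometries H).comap (intRep u))
    (by rwa [Subgroup.mem_comap, intRep_genM]) (by rwa [Subgroup.mem_comap, intRep_genN]) γ

lemma conjHom_mem_specialIsometries {H J P Q : Matrix (Fin 4) (Fin 4) K} (h : P * Q = 1)
    (hJ : J = Qᴴ * H * Q) {A : SL4 K} (hA : A ∈ specialIsometries H) :
    conjHom P Q h A ∈ specialIsometries J := by
  have h' : Q * P = 1 := mul_eq_one_comm.mp h
  have h'' : Pᴴ * Qᴴ = 1 := by rw [← conjTranspose_mul, h', conjTranspose_one]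
  rw [mem_specialIsometries] at *
  rw [coe_conjHom, hJ]
  calc (P * A.1 * Q)ᴴ * (Qᴴ * H * Q) * (P * A.1 * Q)
      = Qᴴ * A.1ᴴ * (Pᴴ * Qᴴ) * H * (Q * P) * A.1 * Q := by
        simp only [conjTranspose_mul, mul_assoc]
    _ = Qᴴ * (A.1ᴴ * H * A.1) * Q := by rw [h', h'', mul_one, mul_one]; simp only [mul_assoc]
    _ = Qᴴ * H * Q := by rw [hA]

/-- The representation of the knot group by isometries of the form `J = Qᴴ H Q`, obtained from the
invariant form `H` of `intRep u` by the change of basis `Q = P⁻¹`. -/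
def unitaryRep (u : Kˣ) {H J : Matrix (Fin 4) (Fin 4) K} (P Q : Matrix (Fin 4) (Fin 4) K)
    (h : P * Q = 1) (hJ : J = Qᴴ * H * Q) (hM : intM u ∈ specialIsometries H)
    (hN : intN u ∈ specialIsometries H) : KnotGroup →* specialIsometries J :=
  ((conjHom P Q h).comp (intRep u)).codRestrict _ fun γ =>
    conjHom_mem_specialIsometries h hJ (intRep_mem_specialIsometries hM hN γ)

end

/-! ### The hyperbolic representation -/

/-- The invariant quadratic form of the representation `intRep` with parameter `u = 1`. -/
def hypForm : Matrix (Fin 4) (Fin 4) ℝ :=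
  !![0, 0, 0, -1 / 2; 0, 1 / 3, -1 / 6, 0; 0, -1 / 6, 1 / 3, 0; -1 / 2, 0, 0, 0]

/-- The standard Lorentzian basis, in coordinates with respect to the basis in which `intRep` is
written. -/
def lorentzBasis : Matrix (Fin 4) (Fin 4) ℝ :=
  !![0, 0, 1, 1; 1, √3, 0, 0; 2, 0, 0, 0; 0, 0, -1, 1]

/-- The inverse of `lorentzBasis`. -/
def lorentzBasisInv : Matrix (Fin 4) (Fin 4) ℝ :=
  !![0, 0, 1 / 2, 0; 0, √3 / 3, -√3 / 6, 0; 1 / 2, 0, 0, -1 / 2; 1 / 2, 0, 0, 1 / 2]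

lemma lorentzBasis_mul_inv : lorentzBasis * lorentzBasisInv = 1 := by
  have h3 := sqrt_three_mul_self
  ext i j
  fin_cases i <;> fin_cases j <;>
    simp [lorentzBasis, lorentzBasisInv, mul_apply, Fin.sum_univ_four] <;> grind

lemma lorentzBasisInv_mul : lorentzBasisInv * lorentzBasis = 1 :=
  mul_eq_one_comm.mp lorentzBasis_mul_inv

lemma diagonal_eq_conj_hypForm :
    diagonal ![1, 1, 1, -1] = lorentzBasisᴴ * hypForm * lorentzBasis := by
  have h3 := sqrt_three_mul_self
  ext i j
  fin_cases i <;> fin_cases j <;>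
    simp [lorentzBasis, hypForm, mul_apply, Fin.sum_univ_four, diagonal] <;> grind

lemma intM_mem_specialIsometries_hypForm : intM (1 : ℝˣ) ∈ specialIsometries hypForm := by
  rw [mem_specialIsometries]
  ext i j
  fin_cases i <;> fin_cases j <;>
    simp [hypForm, intM, mul_apply, Fin.sum_univ_four] <;> norm_num

lemma intN_mem_specialIsometries_hypForm : intN (1 : ℝˣ) ∈ specialIsometries hypForm := by
  rw [mem_specialIsometries]
  ext i j
  fin_cases i <;> fin_cases j <;>
    simp [hypForm, intN, mul_apply, Fin.sum_univ_four] <;> norm_num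

/-- The hyperbolic representation of the figure-eight knot group. -/
def hypRep : KnotGroup →* SO31 :=
  unitaryRep (1 : ℝˣ) lorentzBasisInv lorentzBasis lorentzBasisInv_mul diagonal_eq_conj_hypForm
    intM_mem_specialIsometries_hypForm intN_mem_specialIsometries_hypForm

lemma coe_intRep_one_eq_map {R S : Type*} [CommRing R] [CommRing S] (f : R →+* S)
    (γ : KnotGroup) : (intRep (1 : Sˣ) γ).1 = (intRep (1 : Rˣ) γ).1.map f := by
  have h := DFunLike.congr_fun (map_comp_intRep (1 : Rˣ) f) γ
  rw [map_one] at h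
  rw [← h]
  rfl

lemma intRep_one_real_injective : Function.Injective (intRep (1 : ℝˣ)) := by
  intro γ δ h
  have hmap := congrArg Subtype.val h
  rw [coe_intRep_one_eq_map (Int.castRingHom ℝ), coe_intRep_one_eq_map (Int.castRingHom ℝ)] at hmap
  exact intRep_one_injective
    (Subtype.ext (Matrix.map_injective (RingHom.injective_int (Int.castRingHom ℝ)) hmap))

lemma lorentzBasis_mul_hypRep_mul (γ : KnotGroup) :
    lorentzBasis * (hypRep γ).1.1 * lorentzBasisInv = (intRep (1 : ℝˣ) γ).1 :=
  mul_conj_mul lorentzBasisInv_mul _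

lemma hypRep_injective : Function.Injective hypRep := by
  intro γ δ h
  apply intRep_one_real_injective
  apply Subtype.ext
  rw [← lorentzBasis_mul_hypRep_mul, ← lorentzBasis_mul_hypRep_mul, h]

lemma discreteTopology_of_map_subtype {G : Type*} [Group G] [TopologicalSpace G] {H : Subgroup G}
    {S : Subgroup H} [DiscreteTopology (S.map H.subtype)] : DiscreteTopology S :=
  DiscreteTopology.of_continuous_injective
    (f := fun x : S => (⟨x.1.1, x.1, x.2, rfl⟩ : S.map H.subtype))
    (Continuous.subtype_mk (continuous_subtype_val.comp continuous_subtype_val) _)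
    fun _ _ hxy => Subtype.ext (Subtype.ext (congrArg (fun z => z.1) hxy))

lemma discreteTopology_range_hypRep : DiscreteTopology hypRep.range := by
  suffices DiscreteTopology (hypRep.range.map SO31.subtype) from discreteTopology_of_map_subtype
  refine discreteTopology_of_conj_entries lorentzBasis_mul_inv
    (S := Set.range (Int.castRingHom ℝ)) ?_ ?_
  · rintro _ ⟨a, rfl⟩ _ ⟨b, rfl⟩ h
    have hab : |a - b| < 1 := by
      rw [← map_sub, eq_intCast, Int.norm_cast_real, Int.norm_eq_abs] at h
      exact_mod_cast h
    rw [sub_eq_zero.mp (Int.abs_lt_one_iff.mp hab)]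
  · rintro _ ⟨_, ⟨γ, rfl⟩, rfl⟩ i j
    change (lorentzBasis * (hypRep γ).1.1 * lorentzBasisInv) i j ∈ _
    rw [lorentzBasis_mul_hypRep_mul, coe_intRep_one_eq_map (Int.castRingHom ℝ)]
    exact ⟨_, rfl⟩

/-- The hyperbolic representation, as matrices over the complex numbers. -/
def hypMat (γ : KnotGroup) : Matrix (Fin 4) (Fin 4) ℂ := (hypRep γ).1.1.map Complex.ofRealHom

lemma lorentzBasis_mul_hypMat (γ : KnotGroup) :
    lorentzBasis.map Complex.ofRealHom * hypMat γ =
      (intRep (1 : ℂˣ) γ).1 * lorentzBasis.map Complex.ofRealHom := by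
  rw [hypMat, coe_intRep_one_eq_map Complex.ofRealHom, ← lorentzBasis_mul_hypRep_mul,
    ← Matrix.map_mul, ← Matrix.map_mul, mul_assoc _ lorentzBasisInv, lorentzBasisInv_mul, mul_one]

lemma hypMat_injective : Function.Injective hypMat := fun _ _ h =>
  hypRep_injective (Subtype.ext (Subtype.ext
    (Matrix.map_injective Complex.ofRealHom.injective h)))

lemma hypMat_one : hypMat 1 = 1 := by
  rw [hypMat, map_one]
  exact Matrix.map_one _ (map_zero _) (map_one _)

/-! ### The action on Hermitian matrices -/

/-- The identification of `ℂ⁴`, in the basis in which `intRep` is written, with the complex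
`2 × 2` matrices. -/
def intHerm (y : Fin 4 → ℂ) : Matrix (Fin 2) (Fin 2) ℂ :=
  !![y 0, y 2 / 2 + (1 + 2 * omega) / 3 * (y 1 - y 2 / 2);
     y 2 / 2 - (1 + 2 * omega) / 3 * (y 1 - y 2 / 2), y 3]

/-- The identification of `ℂ⁴`, in the standard basis, with the complex `2 × 2` matrices; it maps
`ℝ⁴` onto the Hermitian matrices. -/
def herm (x : Fin 4 → ℂ) : Matrix (Fin 2) (Fin 2) ℂ :=
  !![x 3 + x 2, x 0 + Complex.I * x 1; x 0 - Complex.I * x 1, x 3 - x 2]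

section
variable (x : Fin 4 → ℂ)

@[simp] lemma herm_zero_zero : herm x 0 0 = x 3 + x 2 := rfl

@[simp] lemma herm_zero_one : herm x 0 1 = x 0 + Complex.I * x 1 := rfl

@[simp] lemma herm_one_zero : herm x 1 0 = x 0 - Complex.I * x 1 := rfl

@[simp] lemma herm_one_one : herm x 1 1 = x 3 - x 2 := rfl

end

lemma herm_injective : Function.Injective herm := by
  intro x y h
  have hentry (i j : Fin 2) : herm x i j = herm y i j := by rw [h]
  have h00 := hentry 0 0
  have h01 := hentry 0 1
  have h10 := hentry 1 0
  have h11 := hentry 1 1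
  simp only [herm_zero_zero, herm_zero_one, herm_one_zero, herm_one_one] at h00 h01 h10 h11
  ext i
  fin_cases i
  · change x 0 = y 0
    linear_combination (h01 + h10) / 2
  · exact mul_left_cancel₀ Complex.I_ne_zero
      (by linear_combination (h01 - h10) / 2 : Complex.I * x 1 = Complex.I * y 1)
  · change x 2 = y 2
    linear_combination (h00 - h11) / 2
  · change x 3 = y 3
    linear_combination (h00 + h11) / 2

lemma herm_surjective : Function.Surjective herm := by
  intro X
  refine ⟨![(X 0 1 + X 1 0) / 2, -Complex.I * (X 0 1 - X 1 0) / 2, (X 0 0 - X 1 1) / 2,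
    (X 0 0 + X 1 1) / 2], ?_⟩
  have hI : Complex.I * Complex.I = -1 := Complex.I_mul_I
  ext i j
  fin_cases i <;> fin_cases j <;> simp <;> grind

lemma herm_smul (c : ℂ) (x : Fin 4 → ℂ) : herm (c • x) = c • herm x := by
  ext i j
  fin_cases i <;> fin_cases j <;> simp <;> ring

lemma herm_zero : herm 0 = 0 := by
  ext i j
  fin_cases i <;> fin_cases j <;> simp

lemma herm_eq_intHerm (x : Fin 4 → ℂ) :
    herm x = intHerm (lorentzBasis.map Complex.ofRealHom *ᵥ x) := by
  have h3 : ((√3 : ℝ) : ℂ) * ((√3 : ℝ) : ℂ) = 3 := by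
    rw [← Complex.ofReal_mul, sqrt_three_mul_self]
    norm_num
  have hω : 1 + 2 * omega = Complex.I * ((√3 : ℝ) : ℂ) := by
    apply Complex.ext
    · simp [omega]
      norm_num
    · simp [omega]
      ring
  ext i j
  fin_cases i <;> fin_cases j <;>
    simp [intHerm, lorentzBasis, mulVec, dotProduct, Fin.sum_univ_four, hω] <;> grind

/-- `A` acts on the matrices `intHerm y` as `B` does by `X ↦ B X Bᴴ`. -/
def IsHermCompatible (A : SL4 ℂ) (B : SL(2, ℂ)) : Prop :=
  ∀ y, intHerm (A.1 *ᵥ y) = B.1 * intHerm y * B.1ᴴ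

lemma isHermCompatible_one : IsHermCompatible 1 1 := fun y => by
  simp only [Matrix.SpecialLinearGroup.coe_one, one_mulVec, conjTranspose_one, one_mul, mul_one]

lemma IsHermCompatible.mul {A A' : SL4 ℂ} {B B' : SL(2, ℂ)} (h : IsHermCompatible A B)
    (h' : IsHermCompatible A' B') : IsHermCompatible (A * A') (B * B') := fun y => by
  rw [Matrix.SpecialLinearGroup.coe_mul, Matrix.SpecialLinearGroup.coe_mul, ← mulVec_mulVec,
    h, h', conjTranspose_mul]
  simp only [mul_assoc]

lemma IsHermCompatible.inv {A : SL4 ℂ} {B : SL(2, ℂ)} (h : IsHermCompatible A B) :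
    IsHermCompatible A⁻¹ B⁻¹ := fun y => by
  have hA : A.1 *ᵥ (A⁻¹.1 *ᵥ y) = y := by
    rw [mulVec_mulVec, ← Matrix.SpecialLinearGroup.coe_mul, mul_inv_cancel,
      Matrix.SpecialLinearGroup.coe_one, one_mulVec]
  have hB : B⁻¹.1 * B.1 = 1 := by
    rw [← Matrix.SpecialLinearGroup.coe_mul, inv_mul_cancel, Matrix.SpecialLinearGroup.coe_one]
  have hB' : B.1ᴴ * B⁻¹.1ᴴ = 1 := by rw [← conjTranspose_mul, hB, conjTranspose_one]
  calc intHerm (A⁻¹.1 *ᵥ y)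
      = (B⁻¹.1 * B.1) * intHerm (A⁻¹.1 *ᵥ y) * (B.1ᴴ * B⁻¹.1ᴴ) := by
        rw [hB, hB', one_mul, mul_one]
    _ = B⁻¹.1 * (B.1 * intHerm (A⁻¹.1 *ᵥ y) * B.1ᴴ) * B⁻¹.1ᴴ := by simp only [mul_assoc]
    _ = B⁻¹.1 * intHerm y * B⁻¹.1ᴴ := by rw [← h, hA]

lemma isHermCompatible_intM_slM : IsHermCompatible (intM 1) slM := fun y => by
  ext i j
  fin_cases i <;> fin_cases j <;>
    simp [intHerm, intM, slM, mulVec, dotProduct, Fin.sum_univ_four, mul_apply,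
      Fin.sum_univ_two] <;> grind

lemma isHermCompatible_intN_slN : IsHermCompatible (intN 1) slN := fun y => by
  have hω := omega_mul_self
  have hstar : (starRingEnd ℂ) omega = -1 - omega := star_omega
  ext i j
  fin_cases i <;> fin_cases j <;>
    simp [intHerm, intN, slN, mulVec, dotProduct, Fin.sum_univ_four, mul_apply,
      Fin.sum_univ_two, hstar] <;> grind

lemma isHermCompatible_intRep_slRep (γ : KnotGroup) :
    IsHermCompatible (intRep 1 γ) (slRep γ) := by
  have hγ : γ ∈ Subgroup.closure {genM, genN} := by simp [closure_genM_genN]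
  induction hγ using Subgroup.closure_induction with
  | mem x hx =>
    rcases hx with rfl | rfl
    · simpa using isHermCompatible_intM_slM
    · simpa using isHermCompatible_intN_slN
  | one => simpa using isHermCompatible_one
  | mul x y _ _ hx hy => simpa using hx.mul hy
  | inv x _ hx => simpa using hx.inv

lemma herm_hypMat_mulVec (γ : KnotGroup) (x : Fin 4 → ℂ) :
    herm (hypMat γ *ᵥ x) = (slRep γ).1 * herm x * (slRep γ).1ᴴ := by
  rw [herm_eq_intHerm, herm_eq_intHerm, ← isHermCompatible_intRep_slRep, mulVec_mulVec,
    mulVec_mulVec, lorentzBasis_mul_hypMat]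

-- `IsTranslation A 0` means `A = ±1`: the representation into `PSL(2, ℂ)` is faithful.
lemma eq_one_of_isTranslation_zero {γ : KnotGroup} (h : IsTranslation (slRep γ) 0) : γ = 1 := by
  obtain ⟨s, hs, hA⟩ := h
  have hss : s * star s = 1 := by rcases mul_self_eq_one_iff.mp hs with rfl | rfl <;> simp
  have hscalar : (slRep γ).1 = s • 1 := by
    rw [hA]
    ext i j
    fin_cases i <;> fin_cases j <;> simp
  have htriv (X : Matrix (Fin 2) (Fin 2) ℂ) : (slRep γ).1 * X * (slRep γ).1ᴴ = X := by
    rw [hscalar, conjTranspose_smul, conjTranspose_one, Matrix.smul_mul, one_mul, Matrix.mul_smul,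
      mul_one, smul_smul, mul_comm, hss, one_smul]
  refine hypMat_injective ?_
  rw [hypMat_one]
  refine Matrix.ext_of_mulVec_single fun j => herm_injective ?_
  rw [herm_hypMat_mulVec, htriv, one_mulVec]

lemma eq_of_isTranslation {γ δ : KnotGroup} {τ : ℂ} (h : IsTranslation (slRep γ) τ)
    (h' : IsTranslation (slRep δ) τ) : γ = δ := by
  have hdiv := h.mul h'.inv
  rw [← map_inv, ← map_mul, add_neg_cancel] at hdiv
  exact mul_inv_eq_one.mp (eq_one_of_isTranslation_zero hdiv)

/-! ### The action on hyperbolic space -/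

/-- The action of the knot group on Minkowski space `ℝ^{3,1}` through the hyperbolic
representation. -/
def hypAct (γ : KnotGroup) (y : Fin 4 → ℝ) : Fin 4 → ℝ := (hypRep γ).1.1 *ᵥ y

lemma hypAct_one (y : Fin 4 → ℝ) : hypAct 1 y = y := by
  rw [hypAct, map_one]
  exact one_mulVec y

lemma hypAct_mul (γ δ : KnotGroup) (y : Fin 4 → ℝ) :
    hypAct (γ * δ) y = hypAct γ (hypAct δ y) := by
  rw [hypAct, hypAct, hypAct, map_mul, mulVec_mulVec]
  rfl

lemma herm_hypAct (γ : KnotGroup) (y : Fin 4 → ℝ) :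
    herm (fun i => (hypAct γ y i : ℂ)) =
      (slRep γ).1 * herm (fun i => (y i : ℂ)) * (slRep γ).1ᴴ := by
  rw [← herm_hypMat_mulVec]
  congr 1
  ext i
  simp [hypAct, hypMat, mulVec, dotProduct]

lemma two_mul_hypRep_three_three (γ : KnotGroup) :
    2 * (hypRep γ).1.1 3 3 = ∑ i, ∑ j, ‖(slRep γ).1 i j‖ ^ 2 := by
  have hone : herm (fun i => ((Pi.single 3 1 : Fin 4 → ℝ) i : ℂ)) = 1 := by
    ext i j
    fin_cases i <;> fin_cases j <;> simp
  have h := herm_hypAct γ (Pi.single 3 1)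
  rw [hone, mul_one, hypAct, mulVec_single_one] at h
  have hdiag (i : Fin 2) : herm (fun k => (((hypRep γ).1.1.col 3) k : ℂ)) i i =
      ((∑ j, ‖(slRep γ).1 i j‖ ^ 2 : ℝ) : ℂ) := by
    rw [h, mul_apply, Complex.ofReal_sum]
    refine Finset.sum_congr rfl fun j _ => ?_
    rw [Complex.ofReal_pow]
    exact Complex.mul_conj' _
  have h00 := hdiag 0
  have h11 := hdiag 1
  rw [herm_zero_zero] at h00
  rw [herm_one_one] at h11
  rw [Fin.sum_univ_two, ← Complex.ofReal_inj, Complex.ofReal_add, ← h00, ← h11, Complex.ofReal_mul]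
  simp only [col_apply, Complex.ofReal_ofNat]
  ring

lemma hypRep_three_three_pos (γ : KnotGroup) : 0 < (hypRep γ).1.1 3 3 := by
  obtain ⟨j, hj⟩ := Function.ne_iff.mp (Matrix.SpecialLinearGroup.row_ne_zero (slRep γ) 0)
  have hsum : 0 < ∑ i, ∑ j, ‖(slRep γ).1 i j‖ ^ 2 :=
    Finset.sum_pos' (fun _ _ => by positivity) ⟨0, Finset.mem_univ _,
      Finset.sum_pos' (fun _ _ => by positivity) ⟨j, Finset.mem_univ _, by
        have := norm_pos_iff.mpr hj
        positivity⟩⟩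
  rw [← two_mul_hypRep_three_three] at hsum
  linarith

lemma lorentzSq_hypAct (γ : KnotGroup) (y : Fin 4 → ℝ) :
    hypAct γ y 0 ^ 2 + hypAct γ y 1 ^ 2 + hypAct γ y 2 ^ 2 - hypAct γ y 3 ^ 2 =
      y 0 ^ 2 + y 1 ^ 2 + y 2 ^ 2 - y 3 ^ 2 := by
  have hform (x : Fin 4 → ℝ) : x ⬝ᵥ (diagonal ![1, 1, 1, -1] *ᵥ x) =
      x 0 ^ 2 + x 1 ^ 2 + x 2 ^ 2 - x 3 ^ 2 := by
    simp only [dotProduct, Fin.sum_univ_four, mulVec_diagonal, cons_val]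
    ring
  have hA : (hypRep γ).1.1ᴴ * diagonal ![1, 1, 1, -1] * (hypRep γ).1.1 =
    diagonal ![1, 1, 1, -1] := (hypRep γ).2
  rw [← hform, ← hform]
  nth_rewrite 2 [← hA]
  rw [← mulVec_mulVec, ← mulVec_mulVec, conjTranspose_eq_transpose_of_trivial,
    dotProduct_mulVec y, vecMul_transpose, hypAct]

/-- The inverse of the height of a point in the upper half-space model. -/
def invHeight (y : Fin 4 → ℝ) : ℝ := y 3 - y 2

/-- The vertical projection of a point to the boundary plane `ℂ` of the upper half-space model. -/
def boundaryCoord (y : Fin 4 → ℝ) : ℂ := (y 0 + Complex.I * y 1) / (invHeight y : ℂ)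

/-- The point `y` of Minkowski space lies in the hyperboloid model of hyperbolic space; the second
condition singles out the upper sheet. -/
structure OnHyperboloid (y : Fin 4 → ℝ) : Prop where
  lorentzSq_eq : y 0 ^ 2 + y 1 ^ 2 + y 2 ^ 2 - y 3 ^ 2 = -1
  invHeight_pos : 0 < invHeight y

lemma OnHyperboloid.boundaryCoord_mul_invHeight {y : Fin 4 → ℝ} (hy : OnHyperboloid y) :
    boundaryCoord y * (invHeight y : ℂ) = y 0 + Complex.I * y 1 :=
  div_mul_cancel₀ _ (by exact_mod_cast hy.invHeight_pos.ne')

lemma OnHyperboloid.herm_eq {y : Fin 4 → ℝ} (hy : OnHyperboloid y) :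
    herm (fun i => (y i : ℂ)) =
      !![boundaryCoord y * star (boundaryCoord y) * invHeight y + 1 / invHeight y,
          boundaryCoord y * invHeight y;
        star (boundaryCoord y) * invHeight y, invHeight y] := by
  have hd : (invHeight y : ℂ) ≠ 0 := by exact_mod_cast hy.invHeight_pos.ne'
  have hw := hy.boundaryCoord_mul_invHeight
  have hw' : star (boundaryCoord y) * invHeight y = y 0 - Complex.I * y 1 := by
    have h := congrArg (starRingEnd ℂ) hw
    simp only [map_mul, map_add, Complex.conj_ofReal, Complex.conj_I] at h
    exact h.trans (by ring)
  have hsq : (y 0 : ℂ) ^ 2 + (y 1 : ℂ) ^ 2 + (y 2 : ℂ) ^ 2 - (y 3 : ℂ) ^ 2 = -1 := by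
    exact_mod_cast hy.lorentzSq_eq
  have hcorner : (y 3 + y 2 : ℂ) =
      boundaryCoord y * star (boundaryCoord y) * invHeight y + 1 / invHeight y := by
    refine mul_right_cancel₀ hd ?_
    calc (y 3 + y 2 : ℂ) * invHeight y
        = (y 0 + Complex.I * y 1) * (y 0 - Complex.I * y 1) + 1 := by
          rw [invHeight, Complex.ofReal_sub]
          linear_combination -hsq + (y 1 : ℂ) ^ 2 * Complex.I_sq
      _ = (boundaryCoord y * star (boundaryCoord y) * invHeight y + 1 / invHeight y) *
            invHeight y := by
          rw [← hw, ← hw', add_mul, div_mul_cancel₀ _ hd]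
          ring
  ext i j
  fin_cases i <;> fin_cases j
  · exact hcorner
  · exact hw.symm
  · exact hw'.symm
  · simp [invHeight]

lemma invHeight_hypAct (γ : KnotGroup) {y : Fin 4 → ℝ} (hy : OnHyperboloid y) :
    invHeight (hypAct γ y) =
      invHeight y * ‖(slRep γ).1 1 0 * boundaryCoord y + (slRep γ).1 1 1‖ ^ 2 +
        ‖(slRep γ).1 1 0‖ ^ 2 / invHeight y := by
  have h := congrFun (congrFun (herm_hypAct γ y) 1) 1
  rw [herm_one_one, hy.herm_eq] at h
  rw [← Complex.ofReal_inj, invHeight, Complex.ofReal_sub, h]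
  push_cast
  rw [← Complex.mul_conj', ← Complex.mul_conj']
  simp only [mul_apply, Fin.sum_univ_two, conjTranspose_apply, of_apply, cons_val', cons_val_zero,
    cons_val_one, cons_val_fin_one, map_add, map_mul, ← starRingEnd_apply]
  ring

lemma IsTranslation.invHeight_hypAct {γ : KnotGroup} {τ : ℂ} (h : IsTranslation (slRep γ) τ)
    {y : Fin 4 → ℝ} (hy : OnHyperboloid y) : invHeight (hypAct γ y) = invHeight y := by
  obtain ⟨s, hs, hA⟩ := h
  have hnorm : ‖s‖ = 1 := by rcases mul_self_eq_one_iff.mp hs with rfl | rfl <;> simp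
  rw [FigureEight.invHeight_hypAct γ hy, hA]
  simp [hnorm]

lemma min_le_invHeight_hypAct (γ : KnotGroup) {y : Fin 4 → ℝ} (hy : OnHyperboloid y) :
    min (invHeight y) (1 / invHeight y) ≤ invHeight (hypAct γ y) := by
  have hpos := hy.invHeight_pos
  have one_le_normSq (j : Fin 2) (hj : (slRep γ).1 1 j ≠ 0) : 1 ≤ ‖(slRep γ).1 1 j‖ ^ 2 :=
    one_le_pow₀ (one_le_norm_quadRing star_omega_eq_neg_intCast_sub
      (slRep_mem_eisenstein γ 1 j) hj)
  rw [invHeight_hypAct γ hy]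
  by_cases hc : (slRep γ).1 1 0 = 0
  · have he : (slRep γ).1 1 1 ≠ 0 := fun he =>
      Matrix.SpecialLinearGroup.row_ne_zero (slRep γ) 1
        (funext (Fin.forall_fin_two.mpr ⟨hc, he⟩))
    refine (min_le_left _ _).trans ?_
    rw [hc, zero_mul, zero_add, norm_zero, zero_pow two_ne_zero, zero_div, add_zero]
    exact le_mul_of_one_le_right hpos.le (one_le_normSq 1 he)
  · refine (min_le_right _ _).trans (le_add_of_nonneg_of_le (by positivity) ?_)
    gcongr
    exact one_le_normSq 0 hc

lemma OnHyperboloid.hypAct {y : Fin 4 → ℝ} (hy : OnHyperboloid y) (γ : KnotGroup) :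
    OnHyperboloid (hypAct γ y) where
  lorentzSq_eq := (lorentzSq_hypAct γ y).trans hy.lorentzSq_eq
  invHeight_pos := by
    have hpos := hy.invHeight_pos
    exact (lt_min hpos (by positivity)).trans_le (min_le_invHeight_hypAct γ hy)

lemma IsTranslation.boundaryCoord_hypAct {γ : KnotGroup} {τ : ℂ}
    (h : IsTranslation (slRep γ) τ) {y : Fin 4 → ℝ} (hy : OnHyperboloid y) :
    boundaryCoord (hypAct γ y) = boundaryCoord y + τ := by
  have hd : (invHeight y : ℂ) ≠ 0 := by exact_mod_cast hy.invHeight_pos.ne'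
  have hinv := h.invHeight_hypAct hy
  obtain ⟨s, hs, hA⟩ := h
  have hstar : star s = s := by rcases mul_self_eq_one_iff.mp hs with rfl | rfl <;> simp
  have h01 := congrFun (congrFun (herm_hypAct γ y) 0) 1
  rw [(hy.hypAct γ).herm_eq, hy.herm_eq, hA, hinv] at h01
  simp only [mul_apply, Fin.sum_univ_two, conjTranspose_apply, of_apply, cons_val', cons_val_zero,
    cons_val_one, cons_val_fin_one, star_zero, hstar] at h01
  refine mul_right_cancel₀ hd (h01.trans ?_)
  linear_combination (boundaryCoord y + τ) * invHeight y * hs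

lemma OnHyperboloid.eq_hyperboloidPoint {y : Fin 4 → ℝ} (hy : OnHyperboloid y) :
    y = hyperboloidPoint ![y 0, y 1, y 2] := by
  obtain ⟨hsq, hpos⟩ := hy
  rw [invHeight] at hpos
  have h3 : 0 ≤ y 3 := by nlinarith [sq_nonneg (y 0), sq_nonneg (y 1)]
  have hsqrt : √(1 + y 0 ^ 2 + y 1 ^ 2 + y 2 ^ 2) = y 3 := by
    rw [← Real.sqrt_sq h3]
    congr 1
    linarith
  ext i
  fin_cases i <;> simp [hyperboloidPoint, hsqrt]

lemma onHyperboloid_hyperboloidPoint (x : Fin 3 → ℝ) : OnHyperboloid (hyperboloidPoint x) where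
  lorentzSq_eq := by
    have hs : √(1 + x 0 ^ 2 + x 1 ^ 2 + x 2 ^ 2) ^ 2 = 1 + x 0 ^ 2 + x 1 ^ 2 + x 2 ^ 2 :=
      Real.sq_sqrt (by positivity)
    simp [hyperboloidPoint, hs]
  invHeight_pos := by
    change 0 < √(1 + x 0 ^ 2 + x 1 ^ 2 + x 2 ^ 2) - x 2
    rw [sub_pos]
    apply Real.lt_sqrt_of_sq_lt
    nlinarith [sq_nonneg (x 0), sq_nonneg (x 1)]

/-! ### A region of finite volume meeting every orbit -/

lemma exists_invHeight_hypAct_le {y : Fin 4 → ℝ} (hy : OnHyperboloid y) (h : 2 ≤ invHeight y) :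
    ∃ δ, invHeight (hypAct δ y) ≤ 7 / 8 * invHeight y := by
  have hpos := hy.invHeight_pos
  obtain ⟨δ, hnorm, hcenter⟩ := exists_isometricSphere (boundaryCoord y)
  refine ⟨δ, ?_⟩
  have hinv : 1 / invHeight y ≤ 7 / 16 * invHeight y := by
    rw [div_le_iff₀ hpos]
    nlinarith
  have hmul := mul_le_mul_of_nonneg_left hcenter hpos.le
  rw [invHeight_hypAct δ hy, hnorm, one_pow]
  linarith

lemma exists_invHeight_hypAct_le_two {y : Fin 4 → ℝ} (hy : OnHyperboloid y) :
    ∃ γ, invHeight (hypAct γ y) ≤ 2 := by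
  by_contra! hlarge
  have hpos := hy.invHeight_pos
  have hdecay (k : ℕ) : ∃ γ, invHeight (hypAct γ y) ≤ (7 / 8) ^ k * invHeight y := by
    induction k with
    | zero => exact ⟨1, by rw [hypAct_one, pow_zero, one_mul]⟩
    | succ k ih =>
      obtain ⟨γ, hγ⟩ := ih
      obtain ⟨δ, hδ⟩ := exists_invHeight_hypAct_le (hy.hypAct γ) (hlarge γ).le
      refine ⟨δ * γ, ?_⟩
      rw [hypAct_mul, pow_succ']
      linarith
  have hmin : 0 < min (invHeight y) (1 / invHeight y) := lt_min hpos (by positivity)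
  obtain ⟨k, hk⟩ := exists_pow_lt_of_lt_one (div_pos hmin hpos) (by norm_num : (7 / 8 : ℝ) < 1)
  obtain ⟨γ, hγ⟩ := hdecay k
  rw [lt_div_iff₀ hpos] at hk
  linarith [min_le_invHeight_hypAct γ hy]

lemma exists_peripheral_near (z : ℂ) :
    ∃ a b : ℤ, |(z + (a + b * (2 + 4 * omega))).re| ≤ 1 ∧
      |(z + (a + b * (2 + 4 * omega))).im| ≤ 2 := by
  have h3 := sqrt_three_mul_self
  refine ⟨-round z.re, -round (z.im / (2 * √3)), ?_, ?_⟩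
  · have hre : (z + ((-round z.re : ℤ) + (-round (z.im / (2 * √3)) : ℤ) * (2 + 4 * omega))).re =
        z.re - round z.re := by
      simp [omega]
      ring
    rw [hre]
    exact (abs_sub_round _).trans (by norm_num)
  · have him : (z + ((-round z.re : ℤ) + (-round (z.im / (2 * √3)) : ℤ) * (2 + 4 * omega))).im =
        (2 * √3) * (z.im / (2 * √3) - round (z.im / (2 * √3))) := by
      simp [omega]
      field_simp
      ring
    rw [him, abs_mul, abs_of_pos (by positivity)]
    have hround := abs_sub_round (z.im / (2 * √3))
    have hle : √3 ≤ 2 := by nlinarith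
    nlinarith [Real.sqrt_nonneg 3]

/-- The `k`-th box covering the cusp. Its width decays like `1 / k`, as the Euclidean cross-section
of a cusp does in the Lorentzian coordinates; the constant `99` is generous. -/
def cuspBox (k : ℕ) : Set (Fin 3 → ℝ) :=
  Set.Icc ![-(99 / ((k : ℝ) + 1)), -(99 / ((k : ℝ) + 1)), k - 1]
    ![99 / ((k : ℝ) + 1), 99 / ((k : ℝ) + 1), k]

/-- A union of boxes which contains a fundamental domain. -/
def cuspRegion : Set (Fin 3 → ℝ) := ⋃ k : ℕ, cuspBox k

lemma measurableSet_cuspRegion : MeasurableSet cuspRegion :=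
  MeasurableSet.iUnion fun _ => measurableSet_Icc

lemma hyperbolicVolume_le_volume (S : Set (Fin 3 → ℝ)) : hyperbolicVolume S ≤ volume S :=
  calc hyperbolicVolume S ≤ ∫⁻ _ in S, 1 := by
        refine lintegral_mono fun x => ?_
        rw [← ENNReal.ofReal_one]
        apply ENNReal.ofReal_le_ofReal
        rw [div_le_one (by positivity)]
        apply Real.one_le_sqrt.mpr
        nlinarith [sq_nonneg (x 0), sq_nonneg (x 1), sq_nonneg (x 2)]
    _ = volume S := by simp

lemma volume_cuspBox (k : ℕ) :
    volume (cuspBox k) = ENNReal.ofReal (198 ^ 2 * (1 / ((k : ℝ) + 1) ^ 2)) := by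
  rw [cuspBox, Real.volume_Icc_pi, Fin.prod_univ_three]
  simp only [cons_val_zero, cons_val_one, cons_val]
  rw [← ENNReal.ofReal_mul (by rw [sub_neg_eq_add]; positivity),
    ← ENNReal.ofReal_mul (by rw [sub_neg_eq_add]; positivity)]
  congr 1
  field_simp
  ring

lemma hyperbolicVolume_cuspRegion_lt_top : hyperbolicVolume cuspRegion < ⊤ := by
  have hsum : Summable fun k : ℕ => 198 ^ 2 * (1 / ((k : ℝ) + 1) ^ 2) := by
    apply Summable.mul_left
    simpa using (summable_nat_add_iff 1).mpr (Real.summable_one_div_nat_pow.mpr one_lt_two)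
  calc hyperbolicVolume cuspRegion ≤ volume cuspRegion := hyperbolicVolume_le_volume _
    _ ≤ ∑' k, volume (cuspBox k) := measure_iUnion_le _
    _ = ∑' k : ℕ, ENNReal.ofReal (198 ^ 2 * (1 / ((k : ℝ) + 1) ^ 2)) := by
        simp only [volume_cuspBox]
    _ < ⊤ := hsum.tsum_ofReal_lt_top

lemma mem_cuspRegion {y : Fin 4 → ℝ} (hy : OnHyperboloid y) (hd : invHeight y ≤ 2)
    (h0 : |y 0| ≤ 2 * invHeight y) (h1 : |y 1| ≤ 2 * invHeight y) :
    ![y 0, y 1, y 2] ∈ cuspRegion := by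
  obtain ⟨hform, hpos⟩ := hy
  obtain ⟨k, hk1, hk2, hk3⟩ :
      ∃ k : ℕ, (k : ℝ) - 1 ≤ y 2 ∧ y 2 ≤ k ∧ 2 * invHeight y * ((k : ℝ) + 1) ≤ 99 := by
    have hprod : invHeight y * (y 3 + y 2) ≤ 33 := by
      have e0 := sq_le_sq' (neg_le_of_abs_le h0) (le_of_abs_le h0)
      have e1 := sq_le_sq' (neg_le_of_abs_le h1) (le_of_abs_le h1)
      rw [invHeight] at *
      nlinarith
    rw [invHeight] at *
    rcases le_total (y 2) 0 with hneg | hnonneg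
    · refine ⟨0, ?_, by simpa using hneg, by push_cast; linarith⟩
      by_contra! hlt
      push_cast at hlt
      nlinarith [sq_nonneg (y 0), sq_nonneg (y 1)]
    · have hceil := Nat.ceil_lt_add_one hnonneg
      exact ⟨⌈y 2⌉₊, by linarith, Nat.le_ceil _, by nlinarith⟩
  have hbound : 2 * invHeight y ≤ 99 / ((k : ℝ) + 1) := by
    rwa [le_div_iff₀ (by positivity)]
  have b0 := abs_le.mp (h0.trans hbound)
  have b1 := abs_le.mp (h1.trans hbound)
  refine Set.mem_iUnion.mpr ⟨k, Set.mem_Icc.mpr ⟨fun i => ?_, fun i => ?_⟩⟩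
  · fin_cases i
    exacts [b0.1, b1.1, hk1]
  · fin_cases i
    exacts [b0.2, b1.2, hk2]

lemma exists_mem_cuspRegion {y : Fin 4 → ℝ} (hy : OnHyperboloid y) :
    ∃ γ, ∃ x ∈ cuspRegion, hypAct γ y = hyperboloidPoint x := by
  obtain ⟨γ, hγ⟩ := exists_invHeight_hypAct_le_two hy
  obtain ⟨a, b, hre, him⟩ := exists_peripheral_near (boundaryCoord (hypAct γ y))
  have htrans := isTranslation_peripheral a b
  have hinv := htrans.invHeight_hypAct (hy.hypAct γ)
  have hcoord := htrans.boundaryCoord_hypAct (hy.hypAct γ)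
  rw [← hypAct_mul] at hinv hcoord
  set x := hypAct (genM ^ a * longitude ^ b * γ) y
  have hx : OnHyperboloid x := hy.hypAct _
  refine ⟨genM ^ a * longitude ^ b * γ, _, mem_cuspRegion hx (hinv ▸ hγ) ?_ ?_,
    hx.eq_hyperboloidPoint⟩ <;> rw [← hcoord] at hre him
  · have hx0 : x 0 = (boundaryCoord x).re * invHeight x := by
      simpa using congrArg Complex.re hx.boundaryCoord_mul_invHeight.symm
    rw [hx0, abs_mul, abs_of_pos hx.invHeight_pos]
    nlinarith [hx.invHeight_pos]
  · have hx1 : x 1 = (boundaryCoord x).im * invHeight x := by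
      simpa using congrArg Complex.im hx.boundaryCoord_mul_invHeight.symm
    rw [hx1, abs_mul, abs_of_pos hx.invHeight_pos]
    nlinarith [hx.invHeight_pos]

lemma isHyperbolicRep_hypRep : IsHyperbolicRep hypRep where
  sheet := hypRep_three_three_pos
  faithful := hypRep_injective
  discrete := discreteTopology_range_hypRep
  finite_covolume := by
    refine ⟨cuspRegion, measurableSet_cuspRegion, hyperbolicVolume_cuspRegion_lt_top, fun x => ?_⟩
    obtain ⟨γ, y, hy, h⟩ := exists_mem_cuspRegion (onHyperboloid_hyperboloidPoint x)
    refine ⟨γ⁻¹, y, hy, ?_⟩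
    change FigureEight.hypAct γ⁻¹ (hyperboloidPoint y) = _
    rw [← h, ← hypAct_mul, inv_mul_cancel, hypAct_one]

/-! ### The family of representations -/

/-- The coordinate change from the basis in which `intRep` is written to the one of `matM` and
`matN`. -/
def standardBasis : Matrix (Fin 4) (Fin 4) ℂ :=
  !![1 / 2, 0, 0, 0; 1 / 2, 1, 0, 0; 0, 0, 1 / 2, 1; 0, 0, 0, 1]

/-- The inverse of `standardBasis`. -/
def standardBasisInv : Matrix (Fin 4) (Fin 4) ℂ :=
  !![2, 0, 0, 0; -1, 1, 0, 0; 0, 0, 2, -2; 0, 0, 0, 1]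

lemma standardBasis_mul_inv : standardBasis * standardBasisInv = 1 := by
  ext i j
  fin_cases i <;> fin_cases j <;>
    simp [standardBasis, standardBasisInv, mul_apply, Fin.sum_univ_four]

/-- The representation `ρ_u` of the theorem. -/
def rho (u : Circle) : KnotGroup →* SL4 ℂ :=
  (conjHom standardBasis standardBasisInv standardBasis_mul_inv).comp (intRep (Circle.toUnits u))

lemma coe_rho (u : Circle) (γ : KnotGroup) :
    (rho u γ).1 = standardBasis * (intRep (Circle.toUnits u) γ).1 * standardBasisInv := rfl

lemma rho_genM (u : Circle) : (rho u genM : Matrix (Fin 4) (Fin 4) ℂ) = matM u := by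
  rw [coe_rho, intRep_genM]
  ext i j
  fin_cases i <;> fin_cases j <;>
    simp [standardBasis, standardBasisInv, intM, matM, mul_apply, Fin.sum_univ_four] <;> ring

lemma rho_genN (u : Circle) : (rho u genN : Matrix (Fin 4) (Fin 4) ℂ) = matN u := by
  rw [coe_rho, intRep_genN]
  ext i j
  fin_cases i <;> fin_cases j <;>
    simp [standardBasis, standardBasisInv, intN, matN, mul_apply, Fin.sum_univ_four] <;> ring

lemma intRep_areConjugate_rho (u : Circle) : AreConjugate (intRep (Circle.toUnits u)) (rho u) :=
  areConjugate_of_intertwining standardBasis_mul_inv fun γ => by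
    rw [coe_rho, mul_assoc _ standardBasisInv, mul_eq_one_comm.mp standardBasis_mul_inv, mul_one]

lemma continuous_intRep_genM :
    Continuous fun u : Circle => intRep (Circle.toUnits u) genM := by
  simp only [intRep_genM]
  refine Continuous.subtype_mk (continuous_matrix fun i j => ?_) _
  fin_cases i <;> fin_cases j <;>
    simp only [Circle.toUnits_apply, Units.val_mk0, Fin.zero_eta, Fin.mk_one,
      Fin.reduceFinMk, of_apply, cons_val] <;> fun_prop

lemma continuous_intRep_genN :
    Continuous fun u : Circle => intRep (Circle.toUnits u) genN := by
  have hinv : Continuous fun u : Circle => (u : ℂ)⁻¹ := by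
    simp only [← Circle.coe_inv]
    fun_prop
  simp only [intRep_genN]
  refine Continuous.subtype_mk (continuous_matrix fun i j => ?_) _
  fin_cases i <;> fin_cases j <;>
    simp only [Circle.toUnits_apply, Units.val_mk0, Units.val_inv_eq_inv_val, Fin.zero_eta,
      Fin.mk_one, Fin.reduceFinMk, of_apply, cons_val] <;> fun_prop

lemma continuous_intRep (γ : KnotGroup) :
    Continuous fun u : Circle => intRep (Circle.toUnits u) γ := by
  have hγ : γ ∈ Subgroup.closure {genM, genN} := by simp [closure_genM_genN]
  induction hγ using Subgroup.closure_induction with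
  | mem γ hγ =>
    rcases hγ with rfl | rfl
    · exact continuous_intRep_genM
    · exact continuous_intRep_genN
  | one => simpa only [map_one] using continuous_const
  | mul γ δ _ _ hγ hδ =>
    simp only [map_mul]
    exact hγ.mul hδ
  | inv γ _ hγ =>
    simp only [map_inv]
    exact hγ.inv

lemma continuous_rho (γ : KnotGroup) : Continuous fun u : Circle => rho u γ := by
  refine Continuous.subtype_mk ?_ _
  exact (continuous_const.matrix_mul
    (continuous_subtype_val.comp (continuous_intRep γ))).matrix_mul continuous_const

lemma hypRep_areConjugate_rho :
    AreConjugate (complexify.comp (SO31.subtype.comp hypRep)) (rho 1) := by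
  have hinv : lorentzBasis.map Complex.ofRealHom * lorentzBasisInv.map Complex.ofRealHom = 1 := by
    rw [← Matrix.map_mul, lorentzBasis_mul_inv, Matrix.map_one _ (map_zero _) (map_one _)]
  have hconj : AreConjugate (complexify.comp (SO31.subtype.comp hypRep))
      (intRep (Circle.toUnits 1)) := by
    rw [map_one]
    exact areConjugate_of_intertwining hinv lorentzBasis_mul_hypMat
  exact hconj.trans (intRep_areConjugate_rho 1)

lemma trace_intRep_genM_mul_genN {R : Type*} [CommRing R] (u : Rˣ) :
    (intRep u (genM * genN)).1.trace = 6 + u := by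
  rw [map_mul, intRep_genM, intRep_genN, Matrix.SpecialLinearGroup.coe_mul]
  simp only [trace, diag_apply, mul_apply, Fin.sum_univ_four, intM, intN, of_apply, cons_val]
  ring

lemma AreConjugate.trace_eq {Γ R n : Type} [Group Γ] [CommRing R] [Fintype n] [DecidableEq n]
    {ρ₁ ρ₂ : Γ →* Matrix.SpecialLinearGroup n R} (h : AreConjugate ρ₁ ρ₂) (γ : Γ) :
    (ρ₁ γ).1.trace = (ρ₂ γ).1.trace := by
  obtain ⟨g, hg⟩ := h
  rw [hg, Matrix.SpecialLinearGroup.coe_mul, Matrix.SpecialLinearGroup.coe_mul, trace_mul_comm,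
    ← mul_assoc, ← Matrix.SpecialLinearGroup.coe_mul, inv_mul_cancel,
    Matrix.SpecialLinearGroup.coe_one, one_mul]

lemma not_areConjugate_rho {u v : Circle} (huv : u ≠ v) : ¬ AreConjugate (rho u) (rho v) := by
  intro h
  have hconj : AreConjugate (intRep (Circle.toUnits u)) (intRep (Circle.toUnits v)) :=
    (intRep_areConjugate_rho u).trans (h.trans (intRep_areConjugate_rho v).symm)
  have htrace := hconj.trace_eq (genM * genN)
  rw [trace_intRep_genM_mul_genN, trace_intRep_genM_mul_genN] at htrace
  exact huv (Circle.ext (add_left_cancel htrace))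

/-! ### Discreteness -/

lemma discreteTopology_range_rho {τ : ℂ} {c : ℤ} {h : τ * τ = -(c : ℂ) * τ - 1}
    (hc : star τ = -(c : ℂ) - τ) {u : Circle} (hu : (u : ℂ) ∈ quadRing τ c h) :
    DiscreteTopology (rho u).range := by
  have hinv : ((u⁻¹ : Circle) : ℂ) ∈ quadRing τ c h := by
    rw [Circle.coe_inv_eq_conj]
    exact conj_mem_quadRing hc hu
  let v : (quadRing τ c h)ˣ := ⟨⟨u, hu⟩, ⟨_, hinv⟩, Subtype.ext (by simp), Subtype.ext (by simp)⟩
  have hv : Circle.toUnits u = Units.map ((quadRing τ c h).subtype : _ →* ℂ) v := by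
    ext
    rfl
  refine discreteTopology_of_conj_entries (mul_eq_one_comm.mp standardBasis_mul_inv)
    (S := quadRing τ c h) ?_ ?_
  · intro x hx y hy hxy
    by_contra hne
    exact absurd (one_le_norm_quadRing hc (sub_mem hx hy) (sub_ne_zero.mpr hne)) hxy.not_ge
  · rintro _ ⟨γ, rfl⟩ i j
    rw [coe_rho, mul_conj_mul standardBasis_mul_inv, hv, ← map_comp_intRep]
    exact ((intRep v γ).1 i j).2

lemma discreteTopology_range_rho_exp_neg {τ : ℂ} {c : ℤ} {h : τ * τ = -(c : ℂ) * τ - 1}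
    (hc : star τ = -(c : ℂ) - τ) {α : ℝ} (hα : (Circle.exp α : ℂ) ∈ quadRing τ c h) :
    DiscreteTopology (rho (Circle.exp (-α))).range := by
  refine discreteTopology_range_rho (h := h) hc ?_
  rw [Circle.exp_neg, Circle.coe_inv_eq_conj]
  exact conj_mem_quadRing hc hα

/-- The ring of Gaussian integers `ℤ[i]`. -/
def gaussian : Subring ℂ := quadRing Complex.I 0 (by simp)

lemma star_I_eq_neg_intCast_sub : star Complex.I = -((0 : ℤ) : ℂ) - Complex.I := by
  simp

lemma coe_exp_pi : (Circle.exp Real.pi : ℂ) = -1 := by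
  rw [Circle.coe_exp, Complex.exp_pi_mul_I]

lemma coe_exp_pi_div_two : (Circle.exp (Real.pi / 2) : ℂ) = Complex.I := by
  rw [Circle.coe_exp]
  push_cast
  exact Complex.exp_pi_div_two_mul_I

lemma coe_exp_pi_div_three : (Circle.exp (Real.pi / 3) : ℂ) = 1 + omega := by
  rw [Circle.coe_exp, Complex.exp_mul_I, ← Complex.ofReal_cos, ← Complex.ofReal_sin,
    Real.cos_pi_div_three, Real.sin_pi_div_three]
  apply Complex.ext <;> norm_num [omega]

lemma coe_exp_two_pi_div_three : (Circle.exp (2 * Real.pi / 3) : ℂ) = omega := by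
  rw [show 2 * Real.pi / 3 = Real.pi / 3 + Real.pi / 3 by ring, Circle.exp_add, Circle.coe_mul,
    coe_exp_pi_div_three]
  linear_combination omega_mul_self

lemma exp_pi_div_two_mem_gaussian : (Circle.exp (Real.pi / 2) : ℂ) ∈ gaussian := by
  rw [coe_exp_pi_div_two]
  exact self_mem_quadRing

lemma exp_pi_div_three_mem_eisenstein : (Circle.exp (Real.pi / 3) : ℂ) ∈ eisenstein := by
  rw [coe_exp_pi_div_three]
  exact add_mem (one_mem _) self_mem_quadRing

lemma exp_two_pi_div_three_mem_eisenstein :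
    (Circle.exp (2 * Real.pi / 3) : ℂ) ∈ eisenstein := by
  rw [coe_exp_two_pi_div_three]
  exact self_mem_quadRing

lemma discreteTopology_range_rho_exp {α : ℝ} (hα : α ∈ ({0, Real.pi, Real.pi / 2,
    -(Real.pi / 2), Real.pi / 3, -(Real.pi / 3), 2 * Real.pi / 3, -(2 * Real.pi / 3)} : Set ℝ)) :
    DiscreteTopology (rho (Circle.exp α)).range := by
  have hω := star_omega_eq_neg_intCast_sub
  have hI := star_I_eq_neg_intCast_sub
  rcases hα with rfl | rfl | rfl | rfl | rfl | rfl | rfl | rfl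
  · exact discreteTopology_range_rho hω (show (Circle.exp 0 : ℂ) ∈ eisenstein by simp)
  · exact discreteTopology_range_rho hω
      (by simpa only [coe_exp_pi] using neg_mem (one_mem eisenstein))
  · exact discreteTopology_range_rho hI exp_pi_div_two_mem_gaussian
  · exact discreteTopology_range_rho_exp_neg hI exp_pi_div_two_mem_gaussian
  · exact discreteTopology_range_rho hω exp_pi_div_three_mem_eisenstein
  · exact discreteTopology_range_rho_exp_neg hω exp_pi_div_three_mem_eisenstein
  · exact discreteTopology_range_rho hω exp_two_pi_div_three_mem_eisenstein
  · exact discreteTopology_range_rho_exp_neg hω exp_two_pi_div_three_mem_eisenstein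

/-! ### The invariant Hermitian form -/

/-- The entry `⟨e₁, e₂⟩` of `invForm`. -/
def formMid (u : Circle) : ℂ := -(1 / ((u : ℂ) + 1))

/-- The entry `⟨e₀, e₃⟩` of `invForm`. -/
def formOuter (u : Circle) : ℂ := -(((u : ℂ) ^ 2 + u + 1) / ((u : ℂ) + 1))

/-- The Hermitian form preserved by `intRep u`. It is nondegenerate unless `u` is a primitive cube
root of unity; `u = -1` is excluded because the two off-diagonal entries have `u + 1` in the
denominator. -/
def invForm (u : Circle) : Matrix (Fin 4) (Fin 4) ℂ :=
  !![0, 0, 0, formOuter u; 0, 1, formMid u, 0; 0, star (formMid u), 1, 0;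
    star (formOuter u), 0, 0, 0]

section
variable {u : Circle}

lemma conj_circle (u : Circle) : (starRingEnd ℂ) (u : ℂ) = (u : ℂ)⁻¹ := by
  rw [← Circle.coe_inv_eq_conj, Circle.coe_inv]

lemma inv_add_one_circle (u : Circle) : (u : ℂ)⁻¹ + 1 = (u + 1) / u := by
  have h0 : (u : ℂ) ≠ 0 := u.coe_ne_zero
  field_simp
  ring

lemma star_formMid (hu : (u : ℂ) + 1 ≠ 0) : star (formMid u) = -(u / ((u : ℂ) + 1)) := by
  have h0 : (u : ℂ) ≠ 0 := u.coe_ne_zero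
  rw [formMid]
  simp only [star_neg, Complex.star_def, map_div₀, map_add, map_one, conj_circle,
    inv_add_one_circle]
  field_simp

lemma star_formOuter (hu : (u : ℂ) + 1 ≠ 0) :
    star (formOuter u) = -(((u : ℂ) ^ 2 + u + 1) / (u * ((u : ℂ) + 1))) := by
  have h0 : (u : ℂ) ≠ 0 := u.coe_ne_zero
  rw [formOuter]
  simp only [star_neg, Complex.star_def, map_div₀, map_add, map_one, map_pow, conj_circle,
    inv_add_one_circle]
  field_simp
  ring

lemma intM_mem_specialIsometries_invForm (hu : (u : ℂ) + 1 ≠ 0) :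
    intM (Circle.toUnits u) ∈ specialIsometries (invForm u) := by
  have h0 : (u : ℂ) ≠ 0 := u.coe_ne_zero
  rw [mem_specialIsometries, invForm, star_formMid hu, star_formOuter hu, formMid, formOuter]
  ext i j
  fin_cases i <;> fin_cases j <;>
    simp [intM, mul_apply, Fin.sum_univ_four, conj_circle] <;> field_simp <;> ring

lemma intN_mem_specialIsometries_invForm (hu : (u : ℂ) + 1 ≠ 0) :
    intN (Circle.toUnits u) ∈ specialIsometries (invForm u) := by
  have h0 : (u : ℂ) ≠ 0 := u.coe_ne_zero
  rw [mem_specialIsometries, invForm, star_formMid hu, star_formOuter hu, formMid, formOuter]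
  ext i j
  fin_cases i <;> fin_cases j <;>
    simp [intN, mul_apply, Fin.sum_univ_four, conj_circle] <;> field_simp <;> ring

/-- For suitable `r` and `q`, a basis which diagonalizes `invForm u`: see `diagBasis_form`. -/
def diagBasis (u : Circle) (r q : ℝ) : Matrix (Fin 4) (Fin 4) ℂ :=
  !![0, 0, q / star (formOuter u), q / star (formOuter u); 1, -formMid u * r, 0, 0; 0, r, 0, 0;
    0, 0, q, -q]

lemma diagBasis_form {r q ε : ℝ} (hK : formOuter u ≠ 0) (hq : q * q = 1 / 2)
    (hr : (1 - ‖formMid u‖ ^ 2) * r ^ 2 = ε) :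
    (diagBasis u r q)ᴴ * invForm u * diagBasis u r q = diagonal ![1, (ε : ℂ), 1, -1] := by
  have hq' : (q : ℂ) * q = 1 / 2 := by
    rw [← Complex.ofReal_mul, hq]
    norm_num
  have hr' : (1 - formMid u * (starRingEnd ℂ) (formMid u)) * (r : ℂ) ^ 2 = ε := by
    rw [Complex.mul_conj']
    exact_mod_cast hr
  have hK' : (starRingEnd ℂ) (formOuter u) ≠ 0 := by simpa using hK
  rw [diagBasis, invForm]
  generalize formMid u = e at *
  generalize formOuter u = k at *
  ext i j
  fin_cases i <;> fin_cases j <;> simp [mul_apply, Fin.sum_univ_four, diagonal] <;>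
    field_simp <;> grind

lemma exists_areConjugate_rho {J Q : Matrix (Fin 4) (Fin 4) ℂ} (hJJ : J * J = 1)
    (hJ : J = Qᴴ * invForm u * Q) (hu : (u : ℂ) + 1 ≠ 0) :
    ∃ σ : KnotGroup →* specialIsometries J,
      AreConjugate ((specialIsometries J).subtype.comp σ) (rho u) := by
  set P := J * Qᴴ * invForm u
  have hPQ : P * Q = 1 := by
    rw [mul_assoc, mul_assoc, ← mul_assoc Qᴴ, ← hJ, hJJ]
  have hQP : Q * P = 1 := mul_eq_one_comm.mp hPQ
  refine ⟨unitaryRep (Circle.toUnits u) P Q hPQ hJ (intM_mem_specialIsometries_invForm hu)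
    (intN_mem_specialIsometries_invForm hu), AreConjugate.trans ?_ (intRep_areConjugate_rho u)⟩
  refine areConjugate_of_intertwining hQP fun γ => ?_
  change Q * (P * (intRep (Circle.toUnits u) γ).1 * Q) = _
  rw [← mul_assoc, ← mul_assoc, hQP, one_mul]

end

section
variable {α : ℝ}

lemma norm_exp_add_one_sq (α : ℝ) : ‖(Circle.exp α : ℂ) + 1‖ ^ 2 = 2 + 2 * Real.cos α := by
  rw [← Complex.normSq_eq_norm_sq, Complex.normSq_apply, Circle.coe_exp, Complex.exp_mul_I,
    ← Complex.ofReal_cos, ← Complex.ofReal_sin]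
  simp only [Complex.add_re, Complex.mul_re, Complex.add_im, Complex.mul_im, Complex.ofReal_re,
    Complex.ofReal_im, Complex.I_re, Complex.I_im, Complex.one_re, Complex.one_im]
  nlinarith [Real.sin_sq_add_cos_sq α]

lemma formOuter_eq (hu : (Circle.exp α : ℂ) + 1 ≠ 0) :
    formOuter (Circle.exp α) =
      -((1 + 2 * Real.cos α : ℝ) : ℂ) * Circle.exp α / (Circle.exp α + 1) := by
  have h0 : (Circle.exp α : ℂ) ≠ 0 := Circle.coe_ne_zero _
  have : ((2 * Real.cos α : ℝ) : ℂ) = Circle.exp α + (Circle.exp α : ℂ)⁻¹ := by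
    rw [← Circle.coe_inv, ← Circle.exp_neg, Circle.coe_exp, Circle.coe_exp]
    push_cast
    rw [Complex.two_cos, neg_mul]
  rw [formOuter, Complex.ofReal_add, this]
  field_simp
  push_cast
  ring

lemma one_sub_norm_formMid_sq (hu : (Circle.exp α : ℂ) + 1 ≠ 0) :
    (1 - ‖formMid (Circle.exp α)‖ ^ 2) * (2 + 2 * Real.cos α) = 1 + 2 * Real.cos α := by
  have h : 2 + 2 * Real.cos α ≠ 0 := by
    rw [← norm_exp_add_one_sq]
    positivity
  rw [formMid, norm_neg, norm_div, norm_one, div_pow, norm_exp_add_one_sq, sub_mul, one_pow,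
    one_div, inv_mul_cancel₀ h]
  ring

lemma formOuter_ne_zero (hu : (Circle.exp α : ℂ) + 1 ≠ 0) (hc : 1 + 2 * Real.cos α ≠ 0) :
    formOuter (Circle.exp α) ≠ 0 := by
  rw [formOuter_eq hu]
  exact div_ne_zero (mul_ne_zero (neg_ne_zero.mpr (Complex.ofReal_ne_zero.mpr hc))
    (Circle.coe_ne_zero _)) hu

lemma cos_two_pi_div_three : Real.cos (2 * Real.pi / 3) = -1 / 2 := by
  have : 2 * Real.pi / 3 = Real.pi - Real.pi / 3 := by ring
  rw [this, Real.cos_pi_sub, Real.cos_pi_div_three]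
  norm_num

lemma one_add_two_mul_cos_pos (h : |α| < 2 * Real.pi / 3) : 0 < 1 + 2 * Real.cos α := by
  have hcos := Real.cos_lt_cos_of_nonneg_of_le_pi (abs_nonneg α) (by linarith [Real.pi_pos]) h
  rw [cos_two_pi_div_three, Real.cos_abs] at hcos
  linarith

lemma one_add_two_mul_cos_neg (h : 2 * Real.pi / 3 < |α|) (h' : |α| < Real.pi) :
    1 + 2 * Real.cos α < 0 := by
  have hcos := Real.cos_lt_cos_of_nonneg_of_le_pi (by positivity) h'.le h
  rw [cos_two_pi_div_three, Real.cos_abs] at hcos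
  linarith

lemma neg_one_lt_cos (h : |α| < Real.pi) : -1 < Real.cos α := by
  have hcos := Real.cos_lt_cos_of_nonneg_of_le_pi (abs_nonneg α) le_rfl h
  rwa [Real.cos_pi, Real.cos_abs] at hcos

lemma exp_add_one_ne_zero (h : |α| < Real.pi) : (Circle.exp α : ℂ) + 1 ≠ 0 := by
  intro h0
  have hnorm := norm_exp_add_one_sq α
  rw [h0, norm_zero] at hnorm
  linarith [neg_one_lt_cos h]

lemma inv_sqrt_two_mul_self : (1 / √2) * (1 / √2) = 1 / 2 := by
  rw [div_mul_div_comm, one_mul, Real.mul_self_sqrt (by norm_num)]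

lemma exists_SU31_areConjugate_rho (h : |α| < 2 * Real.pi / 3) :
    ∃ σ : KnotGroup →* SU31, AreConjugate (SU31.subtype.comp σ) (rho (Circle.exp α)) := by
  have hc := one_add_two_mul_cos_pos h
  have hu : (Circle.exp α : ℂ) + 1 ≠ 0 := exp_add_one_ne_zero (by linarith [Real.pi_pos])
  have hD : 0 < 1 - ‖formMid (Circle.exp α)‖ ^ 2 :=
    pos_of_mul_pos_left ((one_sub_norm_formMid_sq hu).symm ▸ hc) (by linarith)
  have hform := diagBasis_form (r := (√(1 - ‖formMid (Circle.exp α)‖ ^ 2))⁻¹) (ε := 1)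
    (formOuter_ne_zero hu hc.ne') inv_sqrt_two_mul_self
    (by rw [inv_pow, Real.sq_sqrt hD.le, mul_inv_cancel₀ hD.ne'])
  rw [Complex.ofReal_one] at hform
  refine exists_areConjugate_rho ?_ hform.symm hu
  ext i j
  fin_cases i <;> fin_cases j <;> simp

lemma exists_SU22_areConjugate_rho (h : 2 * Real.pi / 3 < |α|) (h' : |α| < Real.pi) :
    ∃ σ : KnotGroup →* SU22, AreConjugate (SU22.subtype.comp σ) (rho (Circle.exp α)) := by
  have hc := one_add_two_mul_cos_neg h h'
  have hu := exp_add_one_ne_zero h'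
  have hD : 1 - ‖formMid (Circle.exp α)‖ ^ 2 < 0 := by
    by_contra! hD
    linarith [one_sub_norm_formMid_sq hu ▸ mul_nonneg hD
      (by linarith [Real.neg_one_le_cos α] : 0 ≤ 2 + 2 * Real.cos α)]
  have hform := diagBasis_form (r := (√(-(1 - ‖formMid (Circle.exp α)‖ ^ 2)))⁻¹) (ε := -1)
    (formOuter_ne_zero hu hc.ne) inv_sqrt_two_mul_self
    (by rw [inv_pow, Real.sq_sqrt (neg_pos.mpr hD).le, inv_neg, mul_neg, mul_inv_cancel₀ hD.ne])
  generalize diagBasis (Circle.exp α) _ (1 / √2) = Q at hform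
  -- The negative vectors of `Q` have indices 1 and 3; `SU22` expects them last.
  have hswap : diagonal ![1, 1, -1, -1] = (Q.submatrix id (Equiv.swap 1 2))ᴴ *
      invForm (Circle.exp α) * Q.submatrix id (Equiv.swap 1 2) :=
    calc diagonal ![1, 1, -1, -1]
        = (Qᴴ * invForm (Circle.exp α) * Q).submatrix (Equiv.swap 1 2) (Equiv.swap 1 2) := by
          rw [hform]
          ext i j
          fin_cases i <;> fin_cases j <;> simp [diagonal, Equiv.swap_apply_def]
      _ = _ := rfl
  refine exists_areConjugate_rho ?_ hswap hu
  ext i j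
  fin_cases i <;> fin_cases j <;> simp

end

/-! ### Fixed points of isometries -/

/-- The matrix of the Hermitian form of signature `(3,1)` whose square is `hermSq`. -/
abbrev lorentz : Matrix (Fin 4) (Fin 4) ℂ := diagonal ![1, 1, 1, -1]

lemma star_dotProduct_lorentz_mulVec (x y : Fin 4 → ℂ) : star x ⬝ᵥ (lorentz *ᵥ y) =
    star (x 0) * y 0 + star (x 1) * y 1 + star (x 2) * y 2 - star (x 3) * y 3 := by
  simp [dotProduct, Fin.sum_univ_four, mulVec_diagonal]
  ring

lemma hermSq_eq (z : Fin 4 → ℂ) : (hermSq z : ℂ) = star z ⬝ᵥ (lorentz *ᵥ z) := by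
  have hsq (w : ℂ) : ((‖w‖ : ℝ) : ℂ) ^ 2 = star w * w := (Complex.conj_mul' w).symm
  rw [hermSq, star_dotProduct_lorentz_mulVec]
  push_cast
  rw [hsq, hsq, hsq, hsq]

lemma hermSq_smul (c : ℂ) (z : Fin 4 → ℂ) : hermSq (c • z) = ‖c‖ ^ 2 * hermSq z := by
  simp only [hermSq, Pi.smul_apply, smul_eq_mul, norm_mul]
  ring

lemma star_mulVec_dotProduct_mulVec {n R : Type*} [Fintype n] [CommRing R] [StarRing R]
    {J H P : Matrix n n R} (h : Pᴴ * J * P = H) (x y : n → R) :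
    star (P *ᵥ x) ⬝ᵥ (J *ᵥ (P *ᵥ y)) = star x ⬝ᵥ (H *ᵥ y) := by
  rw [← h, star_mulVec, ← dotProduct_mulVec, mulVec_mulVec, mulVec_mulVec]

lemma hermSq_mulVec (A : SU31) (z : Fin 4 → ℂ) : hermSq (A.1.1 *ᵥ z) = hermSq z := by
  have h : A.1.1ᴴ * lorentz * A.1.1 = lorentz := A.2
  have : (hermSq (A.1.1 *ᵥ z) : ℂ) = hermSq z := by
    rw [hermSq_eq, hermSq_eq, star_mulVec_dotProduct_mulVec h]
  exact_mod_cast this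

lemma exists_pos_hermSq_rep_mk {z : Fin 4 → ℂ} (hz : z ≠ 0) :
    ∃ r : ℝ, 0 < r ∧ hermSq (Projectivization.mk ℂ z hz).rep = r * hermSq z := by
  obtain ⟨a, ha⟩ := Projectivization.exists_smul_eq_mk_rep ℂ z hz
  exact ⟨‖(a : ℂ)‖ ^ 2, pow_pos (norm_pos_iff.mpr a.ne_zero) 2,
    by rw [← ha, Units.smul_def, hermSq_smul]⟩

lemma mk_mem_hyperbolicSpace_iff {z : Fin 4 → ℂ} (hz : z ≠ 0) :
    Projectivization.mk ℂ z hz ∈ hyperbolicSpace ↔ hermSq z < 0 := by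
  obtain ⟨r, hr, h⟩ := exists_pos_hermSq_rep_mk hz
  change hermSq _ < 0 ↔ _
  rw [h, ← smul_eq_mul, smul_neg_iff_of_pos_left hr]

lemma mk_mem_hyperbolicBoundary_iff {z : Fin 4 → ℂ} (hz : z ≠ 0) :
    Projectivization.mk ℂ z hz ∈ hyperbolicBoundary ↔ hermSq z = 0 := by
  obtain ⟨r, hr, h⟩ := exists_pos_hermSq_rep_mk hz
  change hermSq _ = 0 ↔ _
  rw [h, mul_eq_zero_iff_left hr.ne']

lemma smul_mem_hyperbolicSpace_iff (A : SU31) (p : ℙ ℂ (Fin 4 → ℂ)) :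
    (A : SL4 ℂ) • p ∈ hyperbolicSpace ↔ p ∈ hyperbolicSpace := by
  induction p using Projectivization.ind with
  | h z hz =>
    rw [Projectivization.smul_mk, mk_mem_hyperbolicSpace_iff, mk_mem_hyperbolicSpace_iff,
      ← hermSq_mulVec A z]
    rfl

lemma smul_mem_hyperbolicBoundary_iff (A : SU31) (p : ℙ ℂ (Fin 4 → ℂ)) :
    (A : SL4 ℂ) • p ∈ hyperbolicBoundary ↔ p ∈ hyperbolicBoundary := by
  induction p using Projectivization.ind with
  | h z hz =>
    rw [Projectivization.smul_mk, mk_mem_hyperbolicBoundary_iff, mk_mem_hyperbolicBoundary_iff,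
      ← hermSq_mulVec A z]
    rfl

lemma smul_mk_eq_self_iff {n K : Type*} [Fintype n] [DecidableEq n] [Field K]
    (A : Matrix.SpecialLinearGroup n K) {z : n → K} (hz : z ≠ 0) :
    A • Projectivization.mk K z hz = Projectivization.mk K z hz ↔ ∃ c : K, A.1 *ᵥ z = c • z := by
  rw [Projectivization.smul_mk, Projectivization.mk_eq_mk_iff']
  exact exists_congr fun c => eq_comm

lemma smul_eq_self_iff {n K : Type*} [Fintype n] [DecidableEq n] [Field K]
    (A : Matrix.SpecialLinearGroup n K) (p : ℙ K (n → K)) :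
    A • p = p ↔ ∃ c : K, A.1 *ᵥ p.rep = c • p.rep := by
  rw [← smul_mk_eq_self_iff A p.rep_nonzero, p.mk_rep]

lemma eq_zero_of_hermSq_nonpos {z : Fin 4 → ℂ} (h3 : z 3 = 0) (h : hermSq z ≤ 0) : z = 0 := by
  simp only [hermSq, h3, norm_zero] at h
  have h0 : ‖z 0‖ ^ 2 = 0 := by nlinarith [sq_nonneg ‖z 0‖, sq_nonneg ‖z 1‖, sq_nonneg ‖z 2‖]
  have h1 : ‖z 1‖ ^ 2 = 0 := by nlinarith [sq_nonneg ‖z 0‖, sq_nonneg ‖z 1‖, sq_nonneg ‖z 2‖]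
  have h2 : ‖z 2‖ ^ 2 = 0 := by nlinarith [sq_nonneg ‖z 0‖, sq_nonneg ‖z 1‖, sq_nonneg ‖z 2‖]
  ext i
  fin_cases i
  exacts [by simpa using h0, by simpa using h1, by simpa using h2, h3]

lemma hermSq_sub_smul_of_orthogonal {p w : Fin 4 → ℂ} (hp : hermSq p = 0)
    (hpw : star p ⬝ᵥ (lorentz *ᵥ w) = 0) (c : ℂ) : hermSq (w - c • p) = hermSq w := by
  have hpp : star p ⬝ᵥ (lorentz *ᵥ p) = 0 := by rw [← hermSq_eq, hp, Complex.ofReal_zero]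
  have hwp : star w ⬝ᵥ (lorentz *ᵥ p) = 0 := by
    have := congrArg star hpw
    rw [star_dotProduct_lorentz_mulVec] at this ⊢
    simpa [mul_comm] using this
  have : (hermSq (w - c • p) : ℂ) = hermSq w := by
    rw [hermSq_eq, hermSq_eq, mulVec_sub, mulVec_smul, star_sub, star_smul, sub_dotProduct,
      dotProduct_sub, dotProduct_sub, smul_dotProduct, smul_dotProduct, dotProduct_smul,
      dotProduct_smul, hpp, hwp, hpw]
    simp
  exact_mod_cast this

lemma exists_eq_smul_of_orthogonal {p w : Fin 4 → ℂ} (hp0 : p ≠ 0) (hp : hermSq p = 0)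
    (hpw : star p ⬝ᵥ (lorentz *ᵥ w) = 0) (hw : hermSq w ≤ 0) : ∃ c : ℂ, w = c • p := by
  have hp3 : p 3 ≠ 0 := fun h3 => hp0 (eq_zero_of_hermSq_nonpos h3 hp.le)
  refine ⟨w 3 / p 3, sub_eq_zero.mp (eq_zero_of_hermSq_nonpos ?_ ?_)⟩
  · simp [hp3]
  · rwa [hermSq_sub_smul_of_orthogonal hp hpw]

lemma IsParabolic.conj {A B : SU31} (h : IsParabolic (B * A * B⁻¹)) : IsParabolic A := by
  have hfix (p : ℙ ℂ (Fin 4 → ℂ)) :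
      ((B * A * B⁻¹ : SU31) : SL4 ℂ) • (B : SL4 ℂ) • p = (B : SL4 ℂ) • p ↔
        (A : SL4 ℂ) • p = p := by
    rw [Subgroup.coe_mul, Subgroup.coe_mul, Subgroup.coe_inv, mul_smul, inv_smul_smul, mul_smul,
      smul_left_cancel_iff]
  obtain ⟨hneg, p, ⟨hp, hpfix⟩, huniq⟩ := h
  refine ⟨fun q hq hqfix =>
    hneg _ ((smul_mem_hyperbolicSpace_iff B q).mpr hq) ((hfix q).mpr hqfix), ?_⟩
  refine ⟨(B : SL4 ℂ)⁻¹ • p, ⟨?_, ?_⟩, fun q ⟨hq, hqfix⟩ => eq_inv_smul_iff.mpr ?_⟩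
  · rwa [← smul_mem_hyperbolicBoundary_iff B, smul_inv_smul]
  · rwa [← hfix, smul_inv_smul]
  · exact huniq _ ⟨(smul_mem_hyperbolicBoundary_iff B q).mpr hq, (hfix q).mpr hqfix⟩

lemma isParabolic_of_pow {A : SU31} {k : ℕ} {p : ℙ ℂ (Fin 4 → ℂ)} (hp : p ∈ hyperbolicBoundary)
    (hA : ((A ^ k : SU31) : SL4 ℂ) • p = p)
    (huniq : ∀ q : ℙ ℂ (Fin 4 → ℂ), hermSq q.rep ≤ 0 → ((A ^ k : SU31) : SL4 ℂ) • q = q → q = p) :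
    IsParabolic A := by
  rw [Subgroup.coe_pow] at hA huniq
  have hpow {q : ℙ ℂ (Fin 4 → ℂ)} (hq : (A : SL4 ℂ) • q = q) : (A : SL4 ℂ) ^ k • q = q :=
    pow_mem (S := MulAction.stabilizer (SL4 ℂ) q) hq k
  refine ⟨fun q hq hfix => ?_, p, ⟨hp, huniq _ ?_ ?_⟩, fun q ⟨hq, hfix⟩ =>
    huniq q (le_of_eq hq) (hpow hfix)⟩
  · have hqp := huniq q (le_of_lt hq) (hpow hfix)
    exact (lt_irrefl _ : ¬ hermSq p.rep < hermSq p.rep) (lt_of_lt_of_eq (hqp ▸ hq) hp.symm)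
  · exact le_of_eq ((smul_mem_hyperbolicBoundary_iff A p).mpr hp)
  · rw [← mul_smul, ← pow_succ, pow_succ', mul_smul, hA]

/-! ### Eigenvectors of the peripheral elements -/

section Shear

variable {n K : Type*} [Fintype n] [DecidableEq n] [Field K]
  {A B : Matrix.SpecialLinearGroup n K} {e r : n → K} {μ ν : Kˣ} {c d : K}

/-- On the span of the row vectors `e` and `r`, right multiplication by `A` is `μ` times the shear
with coefficient `c` which fixes `e`. -/
def ActsByShear (A : Matrix.SpecialLinearGroup n K) (e r : n → K) (μ : Kˣ) (c : K) : Prop :=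
  e ᵥ* A.1 = μ • e ∧ r ᵥ* A.1 = μ • (r + c • e)

lemma actsByShear_one : ActsByShear (1 : Matrix.SpecialLinearGroup n K) e r 1 0 := by
  simp [ActsByShear]

lemma ActsByShear.mul (hA : ActsByShear A e r μ c) (hB : ActsByShear B e r ν d) :
    ActsByShear (A * B) e r (μ * ν) (c + d) := by
  rw [ActsByShear, Matrix.SpecialLinearGroup.coe_mul, ← vecMul_vecMul, ← vecMul_vecMul, hA.1, hA.2,
    smul_vecMul, smul_vecMul, add_vecMul, smul_vecMul, hB.1, hB.2]
  refine ⟨smul_smul _ _ _, ?_⟩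
  rw [smul_comm c, ← smul_add, smul_smul, add_smul]
  congr 1
  abel

lemma ActsByShear.inv (hA : ActsByShear A e r μ c) : ActsByShear A⁻¹ e r μ⁻¹ (-c) := by
  have hcancel {v w : n → K} (h : w ᵥ* A.1 = v) : v ᵥ* (A⁻¹).1 = w := by
    rw [← h, vecMul_vecMul, ← Matrix.SpecialLinearGroup.coe_mul, mul_inv_cancel,
      Matrix.SpecialLinearGroup.coe_one, vecMul_one]
  constructor <;> apply hcancel
  · rw [smul_vecMul, hA.1, inv_smul_smul]
  · rw [smul_vecMul, add_vecMul, smul_vecMul, hA.1, hA.2, smul_comm (-c), ← smul_add,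
      inv_smul_smul, neg_smul, add_neg_cancel_right]

lemma ActsByShear.zpow (hA : ActsByShear A e r μ c) (k : ℤ) :
    ActsByShear (A ^ k) e r (μ ^ k) (k * c) := by
  induction k using Int.induction_on with
  | zero => simpa using actsByShear_one
  | succ k ih =>
    rw [_root_.zpow_add_one, _root_.zpow_add_one]
    convert ih.mul hA using 1
    push_cast
    ring
  | pred k ih =>
    rw [_root_.zpow_sub_one, _root_.zpow_sub_one]
    convert ih.mul hA.inv using 1
    push_cast
    ring

lemma ActsByShear.coeff_eq_zero (hA : ActsByShear A e r μ c) {v : n → K} {x : K}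
    (hv : A.1 *ᵥ v = x • v) (hev : e ⬝ᵥ v ≠ 0) : c = 0 := by
  have hdot (w : n → K) : (w ᵥ* A.1) ⬝ᵥ v = x * (w ⬝ᵥ v) := by
    rw [← dotProduct_mulVec, hv, dotProduct_smul, smul_eq_mul]
  have he := hdot e
  have hr := hdot r
  rw [hA.1, Units.smul_def, smul_dotProduct, smul_eq_mul] at he
  rw [hA.2, ← mul_right_cancel₀ hev he, Units.smul_def, smul_dotProduct, add_dotProduct,
    smul_dotProduct, smul_eq_mul, smul_eq_mul] at hr
  have h0 : c * (e ⬝ᵥ v) = 0 := add_eq_left.mp (mul_left_cancel₀ μ.ne_zero hr)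
  exact (mul_eq_zero.mp h0).resolve_right hev

end Shear

section Peripheral

variable {K : Type*} [Field K] (u : Kˣ)

lemma actsByShear_intM :
    ActsByShear (intM u) (Pi.single 3 1) (Pi.single 2 1) 1 ((u : K) + 1) := by
  constructor <;> ext i <;> fin_cases i <;> simp [intM]

lemma actsByShear_longitude :
    ActsByShear (intRep u longitude) (Pi.single 3 1) (Pi.single 2 1) u 0 := by
  rw [ActsByShear, coe_intRep_longitude]
  constructor <;> ext i <;> fin_cases i <;> simp [Units.smul_def]

lemma actsByShear_peripheral (a b : ℤ) :
    ActsByShear (intRep u (genM ^ a * longitude ^ b)) (Pi.single 3 1) (Pi.single 2 1) (u ^ b)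
      (a * ((u : K) + 1)) := by
  rw [map_mul, map_zpow, map_zpow, intRep_genM]
  simpa using ((actsByShear_intM u).zpow a).mul ((actsByShear_longitude u).zpow b)

lemma actsByShear_longitude_six_mul :
    ActsByShear (intRep u longitude) (Pi.single 3 1) ![(u : K) - 1, u, 0, 0] u (6 * u) := by
  refine ⟨(actsByShear_longitude u).1, ?_⟩
  have hu : (u : K) * (↑u⁻¹ : K) = 1 := u.mul_inv
  rw [coe_intRep_longitude, Units.smul_def]
  generalize (↑u⁻¹ : K) = x at *
  ext i
  fin_cases i <;> simp [vecMul, dotProduct, Fin.sum_univ_four, -cons_add] <;> grind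

variable {u}

lemma peripheral_eigenvector_apply_last [CharZero K] (hu : (u : K) + 1 ≠ 0) {a b : ℤ}
    (hab : a ≠ 0 ∨ b ≠ 0) {v : Fin 4 → K} {x : K}
    (hv : (intRep u (genM ^ a * longitude ^ b)).1 *ᵥ v = x • v) : v 3 = 0 := by
  by_contra hv3
  rw [← single_one_dotProduct 3 v] at hv3
  have ha : a = 0 := by simpa [hu] using (actsByShear_peripheral u a b).coeff_eq_zero hv hv3
  subst ha
  rw [zpow_zero, one_mul, map_zpow] at hv
  have hb : b = 0 := by
    simpa using ((actsByShear_longitude_six_mul u).zpow b).coeff_eq_zero hv hv3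
  simp [hb] at hab

/-- The point of projective space fixed by the peripheral subgroup in the basis of `intRep`. -/
def cuspPoint (K : Type*) [Field K] : ℙ K (Fin 4 → K) :=
  Projectivization.mk K (Pi.single 0 1) (by simp)

lemma peripheral_smul_cuspPoint (a b : ℤ) :
    intRep u (genM ^ a * longitude ^ b) • cuspPoint K = cuspPoint K := by
  have hm : genM ∈ (MulAction.stabilizer _ (cuspPoint K)).comap (intRep u) := by
    rw [Subgroup.mem_comap, MulAction.mem_stabilizer_iff, intRep_genM, cuspPoint,
      smul_mk_eq_self_iff]
    refine ⟨1, ?_⟩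
    ext i
    fin_cases i <;> simp [intM]
  have hl : longitude ∈ (MulAction.stabilizer _ (cuspPoint K)).comap (intRep u) := by
    rw [Subgroup.mem_comap, MulAction.mem_stabilizer_iff, cuspPoint, smul_mk_eq_self_iff,
      coe_intRep_longitude]
    refine ⟨u, ?_⟩
    ext i
    fin_cases i <;> simp
  exact mul_mem (zpow_mem hm a) (zpow_mem hl b)

end Peripheral

lemma first_row_eq_zero_of_intM_mem {u : ℂˣ} (hu : (u : ℂ) + 1 ≠ 0)
    {H : Matrix (Fin 4) (Fin 4) ℂ} (hM : intM u ∈ specialIsometries H) :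
    H 0 0 = 0 ∧ H 0 1 = 0 ∧ H 0 2 = 0 := by
  rw [mem_specialIsometries] at hM
  have h00 : H 0 0 = 0 := by
    simpa [intM, mul_apply, Fin.sum_univ_four] using congrFun₂ hM 0 2
  have h01 : H 0 1 = 0 := by
    simpa [intM, mul_apply, Fin.sum_univ_four] using congrFun₂ hM 2 1
  have h02 : H 0 2 * ((u : ℂ) + 1) = 0 := by
    simpa [intM, mul_apply, Fin.sum_univ_four, h00, h01] using congrFun₂ hM 0 3
  exact ⟨h00, h01, (mul_eq_zero.mp h02).resolve_right hu⟩

/-! ### Parabolic elements are peripheral -/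

lemma exists_slRep_mulVec_one_eq_zero {v : Fin 2 → ℂ} (hv : ∀ i, v i ∈ eisenstein) :
    ∃ δ, ((slRep δ).1 *ᵥ v) 1 = 0 := by
  -- An isometric sphere covering `v 0 / v 1` lowers `‖v 1‖²`, a natural number.
  obtain ⟨k, hk⟩ := normSq_quadRing star_omega_eq_neg_intCast_sub (hv 1)
  induction k using Nat.strong_induction_on generalizing v with
  | _ k ih =>
    by_cases hv1 : v 1 = 0
    · exact ⟨1, by simpa using hv1⟩
    obtain ⟨δ, -, hδ⟩ := exists_isometricSphere (v 0 / v 1)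
    have hw (i : Fin 2) : ((slRep δ).1 *ᵥ v) i ∈ eisenstein := by
      change ∑ j, (slRep δ).1 i j * v j ∈ eisenstein
      exact sum_mem fun j _ => mul_mem (slRep_mem_eisenstein δ i j) (hv j)
    obtain ⟨l, hl⟩ := normSq_quadRing star_omega_eq_neg_intCast_sub (hw 1)
    have hlt : l < k := by
      have hentry : ((slRep δ).1 *ᵥ v) 1 =
          ((slRep δ).1 1 0 * (v 0 / v 1) + (slRep δ).1 1 1) * v 1 := by
        simp only [mulVec, dotProduct, Fin.sum_univ_two]
        field_simp
      have hkpos : (0 : ℝ) < k := by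
        rw [← hk]
        positivity
      rw [hentry, norm_mul, mul_pow, hk] at hl
      have : (l : ℝ) < k := by nlinarith
      exact_mod_cast this
    obtain ⟨δ', hδ'⟩ := ih l hlt hw hl
    exact ⟨δ' * δ, by rwa [map_mul, Matrix.SpecialLinearGroup.coe_mul, ← mulVec_mulVec]⟩

lemma exists_eigenvector_of_trace_eq {K : Type*} [Field K] {S : Subring K} {A : SL(2, K)}
    (hA : ∀ i j, A.1 i j ∈ S) {ε : K} (hε : ε * ε = 1) (hεS : ε ∈ S)
    (htr : A.1.trace = 2 * ε) : ∃ v ≠ 0, (∀ i, v i ∈ S) ∧ A.1 *ᵥ v = ε • v := by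
  have hdet := A.2
  rw [det_fin_two] at hdet
  rw [trace_fin_two] at htr
  by_cases h : A.1 0 1 = 0 ∧ A.1 0 0 = ε
  · have h11 : A.1 1 1 = ε := by linear_combination htr - h.2
    refine ⟨![0, 1], fun h0 => one_ne_zero (congrFun h0 1), ?_, ?_⟩
    · simp [Fin.forall_fin_two, zero_mem, one_mem]
    · ext i
      fin_cases i <;> simp [mulVec, dotProduct, h.1, h11]
  · refine ⟨![A.1 0 1, ε - A.1 0 0], fun h0 => h ⟨congrFun h0 0, ?_⟩, ?_, ?_⟩
    · exact (sub_eq_zero.mp (congrFun h0 1)).symm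
    · exact Fin.forall_fin_two.mpr ⟨hA 0 1, sub_mem hεS (hA 0 0)⟩
    · ext i
      fin_cases i <;> simp [mulVec, dotProduct] <;> grind

lemma isTranslation_of_mulVec {B : SL(2, ℂ)} {ε x : ℂ} (hε : ε * ε = 1) (hx : x ≠ 0)
    (hB : B.1 *ᵥ ![x, 0] = ε • ![x, 0]) : IsTranslation B (ε * B.1 0 1) := by
  have h00 : B.1 0 0 = ε :=
    mul_right_cancel₀ hx (by simpa [mulVec, dotProduct] using congrFun hB 0)
  have h10 : B.1 1 0 = 0 := by simpa [mulVec, dotProduct, hx] using congrFun hB 1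
  have h11 : B.1 1 1 = ε := by
    have hdet := B.2
    rw [det_fin_two, h00, h10] at hdet
    linear_combination ε * hdet - B.1 1 1 * hε
  refine ⟨ε, hε, ?_⟩
  rw [← mul_assoc, hε, one_mul, eta_fin_two B.1, h00, h10, h11]
  rfl

lemma exists_conj_isTranslation {γ : KnotGroup} (htr : (slRep γ).1.trace ^ 2 = 4) :
    ∃ δ, ∃ τ ∈ eisenstein, IsTranslation (slRep (δ * γ * δ⁻¹)) τ := by
  obtain ⟨ε, hεm, hε, htr⟩ : ∃ ε ∈ eisenstein, ε * ε = 1 ∧ (slRep γ).1.trace = 2 * ε := by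
    rcases sq_eq_sq_iff_eq_or_eq_neg.mp (htr.trans (by norm_num : (4 : ℂ) = 2 ^ 2)) with h | h
    · exact ⟨1, one_mem _, one_mul 1, by rw [h, mul_one]⟩
    · exact ⟨-1, neg_mem (one_mem _), by norm_num, by rw [h, mul_neg_one]⟩
  obtain ⟨v, hv, hvS, hfix⟩ :=
    exists_eigenvector_of_trace_eq (slRep_mem_eisenstein γ) hε hεm htr
  obtain ⟨δ, hδ⟩ := exists_slRep_mulVec_one_eq_zero hvS
  set x := ((slRep δ).1 *ᵥ v) 0
  have hw : (slRep δ).1 *ᵥ v = ![x, 0] := by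
    ext i
    fin_cases i
    exacts [rfl, hδ]
  have hcancel : ((slRep δ)⁻¹).1 *ᵥ ![x, 0] = v := by
    rw [← hw]
    exact inv_smul_smul (slRep δ) v
  have hx : x ≠ 0 := by
    intro hx
    rw [show ![x, 0] = 0 by simp [hx], mulVec_zero] at hcancel
    exact hv hcancel.symm
  refine ⟨δ, _, mul_mem hεm (slRep_mem_eisenstein _ 0 1), isTranslation_of_mulVec hε hx ?_⟩
  rw [map_mul, map_mul, map_inv, Matrix.SpecialLinearGroup.coe_mul,
    Matrix.SpecialLinearGroup.coe_mul, ← mulVec_mulVec, hcancel, ← mulVec_mulVec, hfix,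
    mulVec_smul, hw]

lemma exists_conj_pow_eq_peripheral {γ : KnotGroup} (hγ : γ ≠ 1)
    (htr : (slRep γ).1.trace ^ 2 = 4) : ∃ (δ : KnotGroup) (a b : ℤ), (a ≠ 0 ∨ b ≠ 0) ∧
      (δ * γ * δ⁻¹) ^ 4 = genM ^ a * longitude ^ b := by
  obtain ⟨δ, τ, ⟨p, q, hpq⟩, hδ⟩ := exists_conj_isTranslation htr
  -- The peripheral translations form a sublattice of index four.
  have hpow : (δ * γ * δ⁻¹) ^ 4 = genM ^ (4 * p - 2 * q) * longitude ^ q := by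
    have h4 := hδ.zpow 4
    rw [← map_zpow, hpq] at h4
    refine eq_of_isTranslation (by exact_mod_cast h4) ?_
    convert isTranslation_peripheral (4 * p - 2 * q) q using 1
    push_cast
    ring
  refine ⟨δ, 4 * p - 2 * q, q, ?_, hpow⟩
  by_contra! hcon
  rw [hcon.1, hcon.2, zpow_zero, zpow_zero, mul_one] at hpow
  exact hγ (conj_eq_one_iff.mp (knotGroup_torsionFree four_ne_zero hpow))

lemma isParabolic_of_pow_eq_peripheral {u : Circle} (hu : (u : ℂ) + 1 ≠ 0)
    {σ : KnotGroup →* SU31} (hσ : AreConjugate (SU31.subtype.comp σ) (rho u)) {γ : KnotGroup}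
    {k : ℕ} {a b : ℤ} (hab : a ≠ 0 ∨ b ≠ 0) (hk : γ ^ k = genM ^ a * longitude ^ b) :
    IsParabolic (σ γ) := by
  obtain ⟨g, hg⟩ := hσ.trans (intRep_areConjugate_rho u).symm
  have hfix (p : ℙ ℂ (Fin 4 → ℂ)) : ((σ γ ^ k : SU31) : SL4 ℂ) • p = p ↔
      intRep (Circle.toUnits u) (genM ^ a * longitude ^ b) • g • p = g • p := by
    rw [← hk, hg, mul_smul, inv_smul_smul, mul_smul, smul_left_cancel_iff, ← map_pow]
    rfl
  have hM : intM (Circle.toUnits u) ∈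
      specialIsometries ((g⁻¹).1ᴴ * lorentz * (g⁻¹).1) := by
    rw [← intRep_genM, hg]
    have hg1 : g.1 * (g⁻¹).1 = 1 := congrArg Subtype.val (mul_inv_cancel g)
    exact conjHom_mem_specialIsometries hg1 rfl (σ genM).2
  obtain ⟨h00, h01, h02⟩ := first_row_eq_zero_of_intM_mem hu hM
  have horth (v : Fin 4 → ℂ) (hv : v 3 = 0) :
      star ((g⁻¹).1 *ᵥ Pi.single 0 1) ⬝ᵥ (lorentz *ᵥ ((g⁻¹).1 *ᵥ v)) = 0 := by
    rw [star_mulVec_dotProduct_mulVec rfl]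
    generalize (g⁻¹).1ᴴ * lorentz * (g⁻¹).1 = H at *
    simp [dotProduct, mulVec, Fin.sum_univ_four, h00, h01, h02, hv]
  have hcusp0 : (g⁻¹).1 *ᵥ (Pi.single 0 1 : Fin 4 → ℂ) ≠ 0 :=
    (smul_ne_zero_iff_ne g⁻¹).mpr (by simp)
  have hnull : hermSq ((g⁻¹).1 *ᵥ Pi.single 0 1) = 0 := by
    have := horth (Pi.single 0 1) (by simp)
    rw [← hermSq_eq] at this
    exact_mod_cast this
  refine isParabolic_of_pow (k := k) (p := g⁻¹ • cuspPoint ℂ)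
    ((mk_mem_hyperbolicBoundary_iff hcusp0).mpr hnull)
    (by rw [hfix, smul_inv_smul, peripheral_smul_cuspPoint]) fun q hq hqfix => ?_
  rw [hfix, ← q.mk_rep, Projectivization.smul_mk, smul_mk_eq_self_iff] at hqfix
  obtain ⟨c, hc⟩ := hqfix
  have hw := horth _ (peripheral_eigenvector_apply_last hu hab hc)
  have hcancel : (g⁻¹).1 *ᵥ (g • q.rep) = q.rep := inv_smul_smul g q.rep
  rw [hcancel] at hw
  obtain ⟨d, hd⟩ := exists_eq_smul_of_orthogonal hcusp0 hnull hw hq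
  rw [← q.mk_rep]
  exact (Projectivization.mk_eq_mk_iff' ..).mpr ⟨d, hd.symm⟩

lemma isParabolic_of_trace {u : Circle} (hu : (u : ℂ) + 1 ≠ 0) {σ : KnotGroup →* SU31}
    (hσ : AreConjugate (SU31.subtype.comp σ) (rho u)) {γ : KnotGroup} (hγ : γ ≠ 1)
    (htr : (slRep γ).1.trace ^ 2 = 4) : IsParabolic (σ γ) := by
  obtain ⟨δ, a, b, hab, hpow⟩ := exists_conj_pow_eq_peripheral hγ htr
  refine IsParabolic.conj (B := σ δ) ?_
  rw [← map_mul, ← map_inv, ← map_mul]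
  exact isParabolic_of_pow_eq_peripheral hu hσ hab hpow

/-! ### Types of the elements of the hyperbolic representation -/

lemma smul_hypRep_eq_self_iff (γ : KnotGroup) (p : ℙ ℂ (Fin 4 → ℂ)) :
    (SO31toSU31.comp hypRep γ : SL4 ℂ) • p = p ↔
      ∃ c : ℂ, (slRep γ).1 * herm p.rep * (slRep γ).1ᴴ = c • herm p.rep := by
  rw [smul_eq_self_iff]
  refine exists_congr fun c => ?_
  rw [← herm_hypMat_mulVec, ← herm_smul, herm_injective.eq_iff]
  rfl

lemma exists_add_eq_mul_eq_one {K : Type*} [Field K] [IsAlgClosed K] [NeZero (2 : K)] (t : K) :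
    ∃ x y : K, x + y = t ∧ x * y = 1 := by
  obtain ⟨s, hs⟩ := IsAlgClosed.exists_pow_nat_eq (t ^ 2 - 4) two_pos
  have h2 : (2 : K) ≠ 0 := two_ne_zero
  refine ⟨(t + s) / 2, (t - s) / 2, by field_simp; ring, ?_⟩
  field_simp
  linear_combination -hs

lemma exists_eigenvector_of_add_eq_trace {K : Type*} [Field K] {A : Matrix (Fin 2) (Fin 2) K}
    {x y : K} (htr : x + y = A.trace) (hdet : x * y = A.det) : ∃ v ≠ 0, A *ᵥ v = x • v := by
  have h : (A - x • 1).det = 0 := by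
    rw [trace_fin_two] at htr
    rw [det_fin_two] at hdet
    simp [det_fin_two]
    grind
  obtain ⟨v, hv, hAv⟩ := exists_mulVec_eq_zero_iff.mpr h
  exact ⟨v, hv, by rwa [sub_mulVec, smul_mulVec, one_mulVec, sub_eq_zero] at hAv⟩

lemma hermSq_of_herm_eq_vecMulVec {x : Fin 4 → ℂ} {v : Fin 2 → ℂ}
    (h : herm x = vecMulVec v (star v)) : hermSq x = 0 := by
  have hentry (i j : Fin 2) : herm x i j = v i * star (v j) := by rw [h]; rfl
  have hstar (i j : Fin 2) : star (herm x i j) = star (v i) * v j := by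
    rw [hentry, star_mul', star_star]
  have hI : Complex.I * Complex.I = -1 := Complex.I_mul_I
  have hsq : (hermSq x : ℂ) = 0 := by
    rw [hermSq_eq, star_dotProduct_lorentz_mulVec]
    simp only [Fin.forall_fin_two, herm_zero_zero, herm_zero_one, herm_one_zero, herm_one_one,
      Complex.star_def, map_add, map_sub, map_mul, Complex.conj_I] at hentry hstar ⊢
    grind
  exact_mod_cast hsq

lemma exists_boundary_fixed_of_eigenvector {γ : KnotGroup} {v : Fin 2 → ℂ} {x : ℂ} (hv : v ≠ 0)
    (hγv : (slRep γ).1 *ᵥ v = x • v) : ∃ p : ℙ ℂ (Fin 4 → ℂ), (p ∈ hyperbolicBoundary ∧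
      (SO31toSU31.comp hypRep γ : SL4 ℂ) • p = p) ∧
      ∃ c : ℂ, c ≠ 0 ∧ herm p.rep = c • vecMulVec v (star v) := by
  obtain ⟨z, hz⟩ := herm_surjective (vecMulVec v (star v))
  have hz0 : z ≠ 0 := by
    rintro rfl
    rw [herm_zero] at hz
    refine hv (funext fun i => ?_)
    simpa [vecMulVec_apply] using congrFun₂ hz.symm i i
  obtain ⟨a, ha⟩ := Projectivization.exists_smul_eq_mk_rep ℂ z hz0
  have hrep : herm (Projectivization.mk ℂ z hz0).rep = (a : ℂ) • vecMulVec v (star v) := by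
    rw [← ha, Units.smul_def, herm_smul, hz]
  refine ⟨Projectivization.mk ℂ z hz0, ⟨?_, ?_⟩, a, a.ne_zero, hrep⟩
  · exact (mk_mem_hyperbolicBoundary_iff hz0).mpr (hermSq_of_herm_eq_vecMulVec hz)
  · refine (smul_hypRep_eq_self_iff γ _).mpr ⟨x * star x, ?_⟩
    rw [hrep, Matrix.mul_smul, Matrix.smul_mul, mul_vecMulVec, vecMulVec_mul, ← star_mulVec, hγv,
      star_smul, smul_vecMulVec, vecMulVec_smul, smul_smul, smul_smul, smul_smul]
    congr 1
    ring

lemma exists_eq_smul_of_smul_vecMulVec_eq {m n K : Type*} [Field K] {v w : m → K} {v' w' : n → K}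
    {c d : K} (hd : d ≠ 0) (hw' : w' ≠ 0) (h : d • vecMulVec w w' = c • vecMulVec v v') :
    ∃ a : K, w = a • v := by
  obtain ⟨j, hj⟩ := Function.ne_iff.mp hw'
  rw [Pi.zero_apply] at hj
  refine ⟨c * v' j / (d * w' j), funext fun i => ?_⟩
  have hij : d * (w i * w' j) = c * (v i * v' j) := congrFun₂ h i j
  rw [Pi.smul_apply, smul_eq_mul]
  field_simp
  linear_combination hij

lemma not_isParabolic_one : ¬ IsParabolic 1 := by
  rintro ⟨hneg, -⟩
  refine hneg (Projectivization.mk ℂ (Pi.single 3 1) (by simp)) ?_ (one_smul _ _)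
  rw [mk_mem_hyperbolicSpace_iff]
  simp [hermSq]

lemma trace_sq_of_isParabolic {γ : KnotGroup} (h : IsParabolic (SO31toSU31.comp hypRep γ)) :
    (slRep γ).1.trace ^ 2 = 4 := by
  obtain ⟨x, y, hsum, hprod⟩ := exists_add_eq_mul_eq_one (slRep γ).1.trace
  have hprod' : x * y = (slRep γ).1.det := hprod.trans (slRep γ).2.symm
  obtain ⟨v, hv, hγv⟩ := exists_eigenvector_of_add_eq_trace hsum hprod'
  obtain ⟨w, hw, hγw⟩ := exists_eigenvector_of_add_eq_trace ((add_comm y x).trans hsum)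
    ((mul_comm y x).trans hprod')
  obtain ⟨p, hp, c, -, hpv⟩ := exists_boundary_fixed_of_eigenvector hv hγv
  obtain ⟨q, hq, d, hd, hqw⟩ := exists_boundary_fixed_of_eigenvector hw hγw
  have hpq : d • vecMulVec w (star w) = c • vecMulVec v (star v) := by
    rw [← hqw, ← hpv, h.2.unique hp hq]
  obtain ⟨a, rfl⟩ := exists_eq_smul_of_smul_vecMulVec_eq hd (star_ne_zero.mpr hw) hpq
  have hxy : x = y := by
    rw [mulVec_smul, hγv, smul_comm] at hγw
    exact smul_left_injective ℂ hw hγw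
  rw [← hsum, ← hxy]
  rw [← hxy] at hprod
  linear_combination 4 * hprod

lemma sq_le_of_linear_eq_zero {S A B C a b c d : ℝ} (hS : 0 < S)
    (h : A ^ 2 + B ^ 2 + C ^ 2 = S ^ 2) (h0 : S * d + A * c + B * a + C * b = 0) :
    d ^ 2 ≤ a ^ 2 + b ^ 2 + c ^ 2 := by
  refine le_of_mul_le_mul_left ?_ (pow_pos hS 2)
  calc S ^ 2 * d ^ 2 = (A * c + B * a + C * b) ^ 2 := by
        linear_combination (S * d - (A * c + B * a + C * b)) * h0
    _ ≤ (A ^ 2 + B ^ 2 + C ^ 2) * (a ^ 2 + b ^ 2 + c ^ 2) := by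
        nlinarith [sq_nonneg (A * a - B * c), sq_nonneg (A * b - C * c), sq_nonneg (B * b - C * a)]
    _ = S ^ 2 * (a ^ 2 + b ^ 2 + c ^ 2) := by rw [h]

lemma dotProduct_herm_mulVec_ne_zero {z : Fin 4 → ℂ} (hz : hermSq z < 0) {v : Fin 2 → ℂ}
    (hv : v ≠ 0) : star v ⬝ᵥ (herm z *ᵥ v) ≠ 0 := by
  intro h0
  have hre := congrArg Complex.re h0
  have him := congrArg Complex.im h0
  simp only [dotProduct, mulVec, Fin.sum_univ_two, Pi.star_apply, Complex.star_def, herm_zero_zero,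
    herm_zero_one, herm_one_zero, herm_one_one, Complex.add_re, Complex.add_im, Complex.sub_re,
    Complex.sub_im, Complex.mul_re, Complex.mul_im, Complex.conj_re, Complex.conj_im, Complex.I_re,
    Complex.I_im, Complex.zero_re, Complex.zero_im] at hre him
  have hS : 0 < (v 0).re ^ 2 + (v 0).im ^ 2 + (v 1).re ^ 2 + (v 1).im ^ 2 := by
    obtain ⟨i, hi⟩ := Function.ne_iff.mp hv
    have hpos : 0 < Complex.normSq (v 0) + Complex.normSq (v 1) := by
      fin_cases i
      exacts [add_pos_of_pos_of_nonneg (Complex.normSq_pos.mpr hi) (Complex.normSq_nonneg _),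
        add_pos_of_nonneg_of_pos (Complex.normSq_nonneg _) (Complex.normSq_pos.mpr hi)]
    rw [Complex.normSq_apply, Complex.normSq_apply] at hpos
    linarith
  -- `S z₃ + A z₂ + B z₀ + C z₁ = 0` with real coefficients on the light cone.
  have hcone : ((v 0).re ^ 2 + (v 0).im ^ 2 - (v 1).re ^ 2 - (v 1).im ^ 2) ^ 2 +
      (2 * ((v 0).re * (v 1).re + (v 0).im * (v 1).im)) ^ 2 +
      (-2 * ((v 0).re * (v 1).im - (v 0).im * (v 1).re)) ^ 2 =
      ((v 0).re ^ 2 + (v 0).im ^ 2 + (v 1).re ^ 2 + (v 1).im ^ 2) ^ 2 := by ring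
  have hre_le := sq_le_of_linear_eq_zero (a := (z 0).re) (b := (z 1).re) (c := (z 2).re)
    (d := (z 3).re) hS hcone (by linear_combination hre)
  have him_le := sq_le_of_linear_eq_zero (a := (z 0).im) (b := (z 1).im) (c := (z 2).im)
    (d := (z 3).im) hS hcone (by linear_combination him)
  simp only [hermSq, Complex.sq_norm, Complex.normSq_apply] at hz
  linarith

lemma eq_mul_star_of_mul_conjTranspose_eq {n K : Type*} [Fintype n] [Field K] [StarRing K]
    {A X : Matrix n n K} {c x : K} {v : n → K} (hAX : A * X * Aᴴ = c • X)
    (hAv : Aᴴ *ᵥ v = star x • v) (hXv : star v ⬝ᵥ (X *ᵥ v) ≠ 0) : c = x * star x := by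
  have h := star_mulVec_dotProduct_mulVec (P := Aᴴ) (J := X) rfl v v
  rw [conjTranspose_conjTranspose, hAX, hAv, star_smul, smul_dotProduct, mulVec_smul,
    dotProduct_smul, star_star, smul_mulVec, dotProduct_smul, smul_smul, smul_eq_mul,
    smul_eq_mul] at h
  exact (mul_right_cancel₀ hXv h).symm

lemma exists_real_add_eq_of_mul_eq_one {x y : ℂ} (hxy : x * y = 1)
    (h : x * star x = y * star y) : ∃ r : ℝ, x + y = r ∧ |r| ≤ 2 := by
  have hnorm : ‖x‖ = ‖y‖ := by
    rw [Complex.star_def, Complex.mul_conj', Complex.mul_conj'] at h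
    exact (sq_eq_sq₀ (norm_nonneg x) (norm_nonneg y)).mp (by exact_mod_cast h)
  have hx : ‖x‖ = 1 := by
    have hmul : ‖x‖ * ‖y‖ = 1 := by rw [← norm_mul, hxy, norm_one]
    rw [← hnorm, ← pow_two] at hmul
    exact (pow_eq_one_iff_of_nonneg (norm_nonneg x) two_ne_zero).mp hmul
  have hy : y = star x := by
    refine mul_left_cancel₀ (norm_ne_zero_iff.mp (hx ▸ one_ne_zero) : x ≠ 0) ?_
    rw [hxy, Complex.star_def, Complex.mul_conj', hx, Complex.ofReal_one, one_pow]
  refine ⟨2 * x.re, by rw [hy, Complex.star_def, Complex.add_conj], ?_⟩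
  rw [abs_mul, abs_two]
  linarith [Complex.abs_re_le_norm x]

lemma exists_real_trace_eq {A : Matrix (Fin 2) (Fin 2) ℂ} (hdet : A.det = 1) {z : Fin 4 → ℂ}
    (hz : hermSq z < 0) {c : ℂ} (hfix : A * herm z * Aᴴ = c • herm z) :
    ∃ r : ℝ, A.trace = r ∧ |r| ≤ 2 := by
  obtain ⟨x, y, hsum, hprod⟩ := exists_add_eq_mul_eq_one A.trace
  have heigen {x y : ℂ} (hsum : x + y = A.trace) (hprod : x * y = 1) : c = x * star x := by
    obtain ⟨v, hv, hAv⟩ := exists_eigenvector_of_add_eq_trace (A := Aᴴ) (x := star x)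
      (y := star y) (by rw [trace_conjTranspose, ← hsum, star_add])
      (by rw [det_conjTranspose, hdet, ← hprod, star_mul'])
    exact eq_mul_star_of_mul_conjTranspose_eq hfix hAv (dotProduct_herm_mulVec_ne_zero hz hv)
  have hxy : x * star x = y * star y := (heigen hsum hprod).symm.trans
    (heigen ((add_comm y x).trans hsum) ((mul_comm y x).trans hprod))
  rw [← hsum]
  exact exists_real_add_eq_of_mul_eq_one hprod hxy

lemma pow_twelve_eq_one {R : Type*} [CommRing R] {A : Matrix (Fin 2) (Fin 2) R} (hdet : A.det = 1)
    (h : A.trace = 0 ∨ A.trace ^ 2 = 1) : A ^ 12 = 1 := by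
  have hCH : A ^ 2 = A.trace • A - 1 := by
    rw [det_fin_two] at hdet
    rw [trace_fin_two, pow_two]
    ext i j
    fin_cases i <;> fin_cases j <;> simp [mul_apply, Fin.sum_univ_two] <;> grind
  rcases h with h | h
  · calc A ^ 12 = (A ^ 2) ^ 6 := by rw [← pow_mul]
      _ = 1 := by rw [hCH, h, zero_smul, zero_sub, Even.neg_one_pow (by decide)]
  · have hcube : A ^ 3 = -(A.trace • 1) := by
      rw [pow_succ, hCH, sub_mul, smul_mul_assoc, ← pow_two, hCH, one_mul, smul_sub, smul_smul,
        ← pow_two, h, one_smul]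
      abel
    calc A ^ 12 = (A ^ 3) ^ 4 := by rw [← pow_mul]
      _ = ((A.trace ^ 2) ^ 2) • 1 := by
        rw [hcube, Even.neg_pow (by decide), smul_pow, one_pow, ← pow_mul]
      _ = 1 := by rw [h, one_pow, one_smul]

lemma trace_slRep_ne {γ : KnotGroup} (hγ : γ ≠ 1) :
    (slRep γ).1.trace ≠ 0 ∧ (slRep γ).1.trace ^ 2 ≠ 1 := by
  rw [← not_or]
  intro htr
  have hpow : slRep (γ ^ 12) = 1 := by
    rw [map_pow]
    exact Subtype.ext (pow_twelve_eq_one (slRep γ).2 htr)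
  exact hγ (knotGroup_torsionFree (by norm_num : 12 ≠ 0)
    (eq_one_of_isTranslation_zero (hpow ▸ isTranslation_one)))

lemma exists_intCast_eq_of_mem_eisenstein {r : ℝ} (hr : (r : ℂ) ∈ eisenstein) :
    ∃ a : ℤ, r = a := by
  obtain ⟨a, b, hab⟩ := hr
  have hb : b = 0 := by simpa [omega] using congrArg Complex.im hab
  exact ⟨a, by simpa [hb] using congrArg Complex.re hab⟩

lemma not_isBoundaryElliptic (γ : KnotGroup) :
    ¬ IsBoundaryElliptic (SO31toSU31.comp hypRep γ) := by
  rintro ⟨⟨p₀, hp₀⟩, ⟨p, hp, hfix⟩, -⟩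
  have hγ : γ ≠ 1 := by
    rintro rfl
    rw [map_one] at hp₀
    exact hp₀ (one_smul _ _)
  obtain ⟨c, hc⟩ := (smul_hypRep_eq_self_iff γ p).mp hfix
  obtain ⟨r, htr, hr⟩ := exists_real_trace_eq (slRep γ).2 hp hc
  obtain ⟨a, rfl⟩ : ∃ a : ℤ, r = a := by
    refine exists_intCast_eq_of_mem_eisenstein ?_
    rw [← htr]
    exact sum_mem fun i _ => slRep_mem_eisenstein γ i i
  have hcases : a = 0 ∨ a ^ 2 = 1 ∨ a ^ 2 = 4 := by
    obtain ⟨hlow, hhigh⟩ := abs_le.mp (by exact_mod_cast hr : |a| ≤ 2)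
    interval_cases a <;> norm_num
  obtain ⟨hne0, hne1⟩ := trace_slRep_ne hγ
  rw [htr] at hne0 hne1
  rcases hcases with h | h | h
  · exact hne0 (by exact_mod_cast h)
  · exact hne1 (by exact_mod_cast h)
  · have hconj : AreConjugate (SU31.subtype.comp (SO31toSU31.comp hypRep)) (rho 1) :=
      hypRep_areConjugate_rho
    have hpar := isParabolic_of_trace (by norm_num) hconj hγ (by rw [htr]; exact_mod_cast h)
    exact hpar.1 p hp hfix

lemma isParabolicPreserving {u : Circle} (hu : (u : ℂ) + 1 ≠ 0) {σ : KnotGroup →* SU31}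
    (hσ : AreConjugate (SU31.subtype.comp σ) (rho u)) :
    IsParabolicPreserving (SO31toSU31.comp hypRep) σ := by
  refine fun γ => ⟨fun h => isParabolic_of_trace hu hσ ?_ (trace_sq_of_isParabolic h),
    fun h => absurd h (not_isBoundaryElliptic γ)⟩
  rintro rfl
  rw [map_one] at h
  exact not_isParabolic_one h

end FigureEight

end

theorem theorem1p3 :
    ∃ (ρhyp : FigureEight.KnotGroup →* FigureEight.SO31)
      (ρ : Circle → (FigureEight.KnotGroup →* FigureEight.SL4 ℂ)),
      -- `ρhyp` is the hyperbolic representation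
      FigureEight.IsHyperbolicRep ρhyp ∧
      -- explicit formulas
      (∀ u : Circle,
        (ρ u FigureEight.genM : Matrix (Fin 4) (Fin 4) ℂ) = FigureEight.matM u ∧
        (ρ u FigureEight.genN : Matrix (Fin 4) (Fin 4) ℂ) = FigureEight.matN u) ∧
      -- `ρ` is a deformation of `ρhyp`
      (∀ γ, Continuous fun u : Circle => ρ u γ) ∧
      FigureEight.AreConjugate
        (FigureEight.complexify.comp (FigureEight.SO31.subtype.comp ρhyp)) (ρ 1) ∧
      (∀ u v : Circle, u ≠ v → ¬ FigureEight.AreConjugate (ρ u) (ρ v)) ∧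
      -- representations into SU(3,1), all of them parabolic-preserving
      (∀ α : ℝ, |α| < 2 * Real.pi / 3 →
        (∃ σ : FigureEight.KnotGroup →* FigureEight.SU31,
          FigureEight.AreConjugate (FigureEight.SU31.subtype.comp σ) (ρ (Circle.exp α))) ∧
        ∀ σ : FigureEight.KnotGroup →* FigureEight.SU31,
          FigureEight.AreConjugate (FigureEight.SU31.subtype.comp σ) (ρ (Circle.exp α)) →
            FigureEight.IsParabolicPreserving (FigureEight.SO31toSU31.comp ρhyp) σ) ∧
      -- representations into SU(2,2)
      (∀ α : ℝ, 2 * Real.pi / 3 < |α| → |α| < Real.pi →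
        ∃ σ : FigureEight.KnotGroup →* FigureEight.SU22,
          FigureEight.AreConjugate (FigureEight.SU22.subtype.comp σ) (ρ (Circle.exp α))) ∧
      -- discrete images, for `u = 1, -1, ± i, e^{± iπ/3}, e^{± 2iπ/3}`
      (∀ α ∈ ({0, Real.pi, Real.pi / 2, -(Real.pi / 2), Real.pi / 3, -(Real.pi / 3),
          2 * Real.pi / 3, -(2 * Real.pi / 3)} : Set ℝ),
        DiscreteTopology (ρ (Circle.exp α)).range) := by
  exact ⟨FigureEight.hypRep, FigureEight.rho, FigureEight.isHyperbolicRep_hypRep,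
    fun u => ⟨FigureEight.rho_genM u, FigureEight.rho_genN u⟩, FigureEight.continuous_rho,
    FigureEight.hypRep_areConjugate_rho, fun u v huv => FigureEight.not_areConjugate_rho huv,
    fun α hα => ⟨FigureEight.exists_SU31_areConjugate_rho hα, fun _ hσ =>
      FigureEight.isParabolicPreserving
        (FigureEight.exp_add_one_ne_zero (by linarith [Real.pi_pos])) hσ⟩,
    fun α hα hα' => FigureEight.exists_SU22_areConjugate_rho hα hα',
    fun α hα => FigureEight.discreteTopology_range_rho_exp hα⟩
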